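/- **Setting.** Let $\mathcal C=\operatorname{clos} c_{\mathcal O}=S^2\,\dot\cup\,c_{\mathcal O}$ be a finite regular cell complex which is the closure of a single 3-cell, and view its boundary 2-sphere $S^2$ from outside. $\mathcal C$ is a *3-cell template* if: 1. the 1-skeleton $\mathcal C^1$ has a bipolar orientation (no directed cycles, a single source vertex $\mathbf N$, a single sink vertex $\mathbf S$) and two directed paths $\mathbf{WE},\mathbf{EW}$ (meridians) from $\mathbf N$ to $\mathbf S$, disjoint except for $\mathbf N,\mathbf S$. The meridians decompose $S^2$ into the open hemispheres $\mathbf W$ (to the right of $\mathbf{WE}$) and $\mathbf E$ (to the left of $\mathbf{WE}$); 2. at end points on the meridians other than $\mathbf N,\mathbf S$, edges in $\mathbf W$ are directed towards the meridian and edges in $\mathbf E$ away from it; 3. let $\mathbf{NE}$, $\mathbf{NW}$ be the faces in $\mathbf W$ adjacent to the first edge of $\mathbf{WE}$, $\mathbf{EW}$, and let $\mathbf{SW}$, $\mathbf{SE}$ be the faces in $\mathbf E$ adjacent to the last edge of $\mathbf{WE}$, $\mathbf{EW}$, respectively. Then $\partial\mathbf{NE}$ and $\partial\mathbf{SW}$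 share an edge of $\mathbf{WE}$, and $\partial\mathbf{NW}$ and $\partial\mathbf{SE}$ share an edge of $\mathbf{EW}$. The *dual* $\mathcal C^{2,*}$ of $S^2$ has the faces of $S^2$ as vertices, and the vertices of $S^2$ as faces. Its edges are the edges $e^*$ which cross each edge $e$ of $S^2$ from left to right, joining the two faces adjacent to $e$. Let $w_-^0,w_-^1,w_+^0,w_+^1$ be the dual vertices of $\mathbf{NE},\mathbf{NW},\mathbf{SE},\mathbf{SW}$, respectively. The *cores* $\mathbf W^*,\mathbf E^*$ consist of the duals of all cells in the open hemispheres $\mathbf W$, $\mathbf E$. The *meridian duals* $\mathbf{WE}^*,\mathbf{EW}^*$ consist of the duals of all meridian edges and nonpolar meridian vertices. The *polar circles* are the boundaries $\partial\mathbf N^*,\partial\mathbf S^*$ of the dual faces of $\mathbf N$, $\mathbf S$. The *polar segments* are $w_-^0w_-^1=\mathbf W^*\cap\partial\mathbf N^*$ and $w_+^0w_+^1=\mathbf E^*\cap\partial\mathbf S^*$. Write $|\cdot|$ for the number of edges. **Corollary 5.2.** In the dual $\mathcal C^{2,*}$ of the boundary sphere of any 3-cell template, the following hold. (i) $\partial\mathbf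 N^*$ and $\partial\mathbf S^*$ share an edge if, and only if, the distance of $\mathbf N$ and $\mathbf S$ in $\mathcal C^1$ is $1$. (ii) The 1-skeletons of the cores $\mathbf W^*$ and $\mathbf E^*$ are bipolar, from the North poles $w_-^0$ and $w_+^0$ to the South poles $w_-^1$ and $w_+^1$, respectively. Moreover $w_-^0=w_-^1$ if, and only if, $\mathbf W^*=\{w_-^0\}=\{w_-^1\}$ is a singleton; likewise $w_+^0=w_+^1$ if, and only if, $\mathbf E^*=\{w_+^0\}=\{w_+^1\}$. (iii) The edge distance between $\partial\mathbf N^*$ and $\partial\mathbf S^*$ is at most $1$. We have $w_-^0,w_-^1\in\partial\mathbf N^*$ and $w_+^0,w_+^1\in\partial\mathbf S^*$, and there are at least two distinct directed single-edge bridges between the polar circles: one in $\mathbf{EW}^*$ from $w_-^1$ to $w_+^0$, and one in $\mathbf{WE}^*$ from $w_+^1$ to $w_-^0$. (iv) The polar segments are disjoint simple directed paths from $w_-^0$ to $w_-^1$ and from $w_+^0$ to $w_+^1$, respectively, possibly of length zero. Together with any two bridges as in (iii) they form a simple directed cycle $w_-^0w_-^1w_+^0w_+^1w_-^0$. (v)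 $\mathbf{WE}^*\cap\partial\mathbf N^*$ and $\mathbf{EW}^*\cap\partial\mathbf N^*$ each consist of a single edge. These two edges are distinct, and they precede and follow, respectively, the directed segment $w_-^0w_-^1$ on $\partial\mathbf N^*$. Likewise $\mathbf{EW}^*\cap\partial\mathbf S^*$ and $\mathbf{WE}^*\cap\partial\mathbf S^*$ each consist of a single edge; these are distinct, and precede and follow, respectively, the directed segment $w_+^0w_+^1$ on $\partial\mathbf S^*$. (vi) $|w_-^0w_-^1|\le|\partial\mathbf N^*|-2$ and $|w_+^0w_+^1|\le|\partial\mathbf S^*|-2$. -/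

import Mathlib

/-- A combinatorial map (rotation system): the standard combinatorial description of a finite cell
decomposition of a closed oriented surface. Elements of `D` are darts, i.e. edges together with one
of their two directions. `α` reverses a dart; `σ` sends a dart to the next dart with the same tail,
in counter-clockwise order, the surface being viewed from outside. -/
structure CMap (D : Type*) where
  σ : Equiv.Perm D
  α : Equiv.Perm D
  α_invol : ∀ d, α (α d) = d
  α_ne : ∀ d, α d ≠ d

namespace CMap

variable {D : Type*} (M : CMap D)

/-- The face permutation: the next dart along the boundary of the face to the left. -/
def φ : Equiv.Perm D := M.σ⁻¹ * M.α

/-- Vertices are the cycles of `σ`. -/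
abbrev Vertex : Type _ := Quotient (Equiv.Perm.SameCycle.setoid M.σ)

/-- Edges are the cycles `{d, α d}` of `α`. -/
abbrev Edge : Type _ := Quotient (Equiv.Perm.SameCycle.setoid M.α)

/-- Faces are the cycles of `φ`. -/
abbrev Face : Type _ := Quotient (Equiv.Perm.SameCycle.setoid M.φ)

/-- The vertex at which a dart starts. -/
def tail (d : D) : M.Vertex := Quotient.mk _ d

/-- The vertex at which a dart ends. -/
def head (d : D) : M.Vertex := M.tail (M.α d)

/-- The edge underlying a dart. -/
def edge (d : D) : M.Edge := Quotient.mk _ d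

/-- The face to the left of a dart. -/
def left (d : D) : M.Face := Quotient.mk _ d

/-- The face to the right of a dart. -/
def right (d : D) : M.Face := M.left (M.α d)

/-- The open cells of the complex. -/
inductive Cell : Type _
  | vert (v : M.Vertex) : Cell
  | edge (e : M.Edge) : Cell
  | face (f : M.Face) : Cell

/-- The map describes the 2-sphere: nonempty, connected, Euler characteristic `2`. -/
structure IsSphere : Prop where
  nonempty : Nonempty D
  connected : ∀ x y : D, ∃ g ∈ Subgroup.closure {M.σ, M.α}, g x = y
  euler : Nat.card M.Vertex + Nat.card M.Face = Nat.card M.Edge + 2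

/-- Regularity of the cell complex: closed edges are embedded arcs, and the boundary of every face
is an embedded circle (it meets no vertex and no edge twice). -/
structure IsRegular : Prop where
  tail_ne_head : ∀ d, M.tail d ≠ M.head d
  left_ne_right : ∀ d, M.left d ≠ M.right d
  face_simple : ∀ d d', M.left d = M.left d' → M.tail d = M.tail d' → d = d'

/-- `x.Lt y`: the cell `x` is contained in the boundary of the cell `y`. -/
inductive Cell.Lt : M.Cell → M.Cell → Prop
  | vert_edge (d : D) : Cell.Lt (.vert (M.tail d)) (.edge (M.edge d))
  | edge_face (d : D) : Cell.Lt (.edge (M.edge d)) (.face (M.left d))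
  | vert_face (d : D) : Cell.Lt (.vert (M.tail d)) (.face (M.left d))

/-- The boundary circle of a face, as a set of cells. -/
def faceBoundary (f : M.Face) : Set M.Cell := {c | Cell.Lt M c (.face f)}

/-- The connected component containing the cell `c` of the complement of the closed set `A`
(`A` is a union of cells): cells outside `A` are joined whenever one is in the closure of the
other. -/
def component (A : Set M.Cell) (c : M.Cell) : Set M.Cell :=
  {c' | Relation.ReflTransGen
    (fun x y => x ∉ A ∧ y ∉ A ∧ (Cell.Lt M x y ∨ Cell.Lt M y x)) c c'}

/-- The 1-skeleton as an undirected simple graph. It is used for distances only, so that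
parallel edges do not matter. -/
def skeleton : SimpleGraph M.Vertex :=
  SimpleGraph.fromRel fun u v => ∃ d, M.tail d = u ∧ M.head d = v

/-- An orientation of all edges: exactly one of the two directions of each edge is selected. -/
def IsOrientation (P : Set D) : Prop := ∀ d, d ∈ P ↔ M.α d ∉ P

/-- `M.IsDiPath P u v p`: the list `p` of darts is a directed walk from `u` to `v`, using only
darts selected by `P`. -/
def IsDiPath (P : Set D) : M.Vertex → M.Vertex → List D → Prop
  | u, v, [] => u = v
  | u, v, d :: p => d ∈ P ∧ M.tail d = u ∧ IsDiPath P (M.head d) v p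

/-- A directed cycle without repeated vertices. -/
def IsDiCycle (P : Set D) (p : List D) : Prop :=
  p ≠ [] ∧ (∃ u, M.IsDiPath P u u p) ∧ (p.map M.tail).Nodup

/-- All vertices and edges of a walk `p` which starts at `u`. -/
def pathCells (u : M.Vertex) (p : List D) : Set M.Cell :=
  {c | c = .vert u ∨ ∃ d ∈ p, c = .edge (M.edge d) ∨ c = .vert (M.head d)}

/-- The directed graph with vertex set `X` and directed edges `P` is bipolar from `n` to `s`:
there are no directed cycles, `n` is the only source, `s` is the only sink. -/
structure IsBipolar (P : Set D) (X : Set M.Vertex) (n s : M.Vertex) : Prop where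
  acyclic : ∀ u p, M.IsDiPath P u u p → p = []
  north_mem : n ∈ X
  south_mem : s ∈ X
  source_iff : ∀ v ∈ X, (∀ d ∈ P, M.head d ≠ v) ↔ v = n
  sink_iff : ∀ v ∈ X, (∀ d ∈ P, M.tail d ≠ v) ↔ v = s

/-- The dual complex. The dart `d`, regarded in the dual, is the dual edge which crosses `d` from
left to right; hence it starts in the face to the left of `d` and ends in the face to the right.
The same set of darts which orients `M` thus orients the dual. -/
def dual : CMap D where
  σ := M.φ
  α := M.α
  α_invol := M.α_invol
  α_ne := M.α_ne

theorem dual_φ_eq : M.dual.φ = M.α * M.σ * M.α⁻¹ := by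
  ext d
  have h : M.α⁻¹ = M.α := by
    ext x
    rw [Equiv.Perm.inv_eq_iff_eq, M.α_invol]
  change (M.φ⁻¹ * M.α) d = _
  simp only [φ, mul_inv_rev, inv_inv, h, Equiv.Perm.mul_apply]

/-- The face `v*` of the dual with barycenter `v`. The dual of a dart with head `v` has `v` to its
left. -/
def dualFace : M.Vertex → M.dual.Face :=
  Quotient.map M.α fun a b h => by
    change Equiv.Perm.SameCycle M.dual.φ (M.α a) (M.α b)
    rw [dual_φ_eq]
    exact Equiv.Perm.SameCycle.conj h

/-- Duality of cells: vertices become faces, edges become edges, faces become vertices. -/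
def dualCell : M.Cell → M.dual.Cell
  | .vert v => .face (M.dualFace v)
  | .edge e => .edge e
  | .face f => .vert f

end CMap

/-- The boundary 2-sphere of a regular complex which is the closure of a single 3-cell, with a
bipolar orientation of the 1-skeleton and two disjoint meridian paths. (A single 3-cell attached
along a regular 2-sphere complex carries no further data.) Each meridian is the list of its edges,
directed from `N` to `S`. -/
structure MeridianSphere (D : Type*) extends CMap D where
  sphere : toCMap.IsSphere
  regular : toCMap.IsRegular
  /-- the darts which point in the direction of their edge -/
  pos : Set D
  orientation : toCMap.IsOrientation pos
  N : toCMap.Vertex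
  S : toCMap.Vertex
  bipolar : toCMap.IsBipolar pos Set.univ N S
  WE : List D
  EW : List D
  WE_ne : WE ≠ []
  EW_ne : EW ≠ []
  WE_path : toCMap.IsDiPath pos N S WE
  EW_path : toCMap.IsDiPath pos N S EW
  disjoint : toCMap.pathCells N WE ∩ toCMap.pathCells N EW ⊆ {.vert N, .vert S}

namespace MeridianSphere

variable {D : Type*} (T : MeridianSphere D)

/-- All cells on the two meridians, including the poles. -/
def meridians : Set T.Cell := T.pathCells T.N T.WE ∪ T.pathCells T.N T.EW

/-- The Western hemisphere: the component of the complement of the meridians which lies to the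
right of the meridian `WE` directed from North to South (viewed from outside). -/
def W : Set T.Cell := T.component T.meridians (.face (T.right (T.WE.head T.WE_ne)))

/-- The Eastern hemisphere: the component of the complement of the meridians which lies to the
left of the meridian `WE`. -/
def E : Set T.Cell := T.component T.meridians (.face (T.left (T.WE.head T.WE_ne)))

/-- The face in `W` adjacent to the first edge of `WE`. -/
def NE : T.Face := T.right (T.WE.head T.WE_ne)

/-- The face in `E` adjacent to the last edge of `WE`. -/
def SW : T.Face := T.left (T.WE.getLast T.WE_ne)

/-- The face in `W` adjacent to the first edge of `EW`; `W` is to the left of `EW`. -/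
def NW : T.Face := T.left (T.EW.head T.EW_ne)

/-- The face in `E` adjacent to the last edge of `EW`; `E` is to the right of `EW`. -/
def SE : T.Face := T.right (T.EW.getLast T.EW_ne)

end MeridianSphere

/-- A 3-cell template, given by its boundary sphere. -/
structure ThreeCellTemplate (D : Type*) extends MeridianSphere D where
  /-- In `W`, edges point towards the meridians at nonpolar meridian vertices. -/
  west_edges : ∀ d, .edge (toCMap.edge d) ∈ toMeridianSphere.W →
    .vert (toCMap.head d) ∈ toMeridianSphere.meridians →
    toCMap.head d ≠ N → toCMap.head d ≠ S → d ∈ pos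
  /-- In `E`, edges point away from the meridians at nonpolar meridian vertices. -/
  east_edges : ∀ d, .edge (toCMap.edge d) ∈ toMeridianSphere.E →
    .vert (toCMap.tail d) ∈ toMeridianSphere.meridians →
    toCMap.tail d ≠ N → toCMap.tail d ≠ S → d ∈ pos
  /-- The boundaries of `NE` and `SW` share an edge of `WE`. -/
  overlap_WE : ∃ d ∈ WE, .edge (toCMap.edge d) ∈
    toCMap.faceBoundary toMeridianSphere.NE ∩ toCMap.faceBoundary toMeridianSphere.SW
  /-- The boundaries of `NW` and `SE` share an edge of `EW`. -/
  overlap_EW : ∃ d ∈ EW, .edge (toCMap.edge d) ∈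
    toCMap.faceBoundary toMeridianSphere.NW ∩ toCMap.faceBoundary toMeridianSphere.SE

namespace ThreeCellTemplate

variable {D : Type*} (T : ThreeCellTemplate D)

/-- The dual vertex `w₋⁰`, the barycenter of the face `NE`. -/
def wm0 : T.dual.Vertex := T.NE

/-- The dual vertex `w₋¹`, the barycenter of the face `NW`. -/
def wm1 : T.dual.Vertex := T.NW

/-- The dual vertex `w₊⁰`, the barycenter of the face `SE`. -/
def wp0 : T.dual.Vertex := T.SE

/-- The dual vertex `w₊¹`, the barycenter of the face `SW`. -/
def wp1 : T.dual.Vertex := T.SW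

/-- The Western core `W*`: the duals of all cells in the open hemisphere `W`. -/
def coreW : Set T.dual.Cell := T.dualCell '' T.W

/-- The Eastern core `E*`. -/
def coreE : Set T.dual.Cell := T.dualCell '' T.E

/-- The meridian dual `WE*`: the duals of all edges and nonpolar vertices of `WE`. -/
def dualWE : Set T.dual.Cell :=
  T.dualCell '' (T.pathCells T.N T.WE \ {.vert T.N, .vert T.S})

/-- The meridian dual `EW*`. -/
def dualEW : Set T.dual.Cell :=
  T.dualCell '' (T.pathCells T.N T.EW \ {.vert T.N, .vert T.S})

/-- The polar circle `∂N*`, as a set of dual edges and vertices. -/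
def circleN : Set T.dual.Cell := T.dual.faceBoundary (T.dualFace T.N)

/-- The polar circle `∂S*`. -/
def circleS : Set T.dual.Cell := T.dual.faceBoundary (T.dualFace T.S)

/-- The number of edges in a set of dual cells. -/
noncomputable def edgeLength (A : Set T.dual.Cell) : ℕ :=
  {e : T.dual.Edge | .edge e ∈ A}.ncard

/-- The edge distance, in the dual 1-skeleton, between two sets of dual cells. -/
noncomputable def edgeDist (A B : Set T.dual.Cell) : ℕ∞ :=
  ⨅ (u : T.dual.Vertex) (_ : .vert u ∈ A) (v : T.dual.Vertex) (_ : .vert v ∈ B),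
    T.dual.skeleton.edist u v

/-- A dual core is bipolar with North pole `n` and South pole `s`, with respect to the dual
orientation of its 1-skeleton. -/
def IsCoreBipolar (A : Set T.dual.Cell) (n s : T.dual.Vertex) : Prop :=
  T.dual.IsBipolar {d | d ∈ T.pos ∧ .edge (T.dual.edge d) ∈ A} {w | .vert w ∈ A} n s

/-- A single directed dual edge from `u` to `v` which belongs to the meridian dual `A`. -/
def IsBridge (A : Set T.dual.Cell) (u v : T.dual.Vertex) (b : D) : Prop :=
  b ∈ T.pos ∧ .edge (T.dual.edge b) ∈ A ∧ T.dual.tail b = u ∧ T.dual.head b = v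

/-- `p` is a directed dual path from `u` to `v`, without repeated vertices, which consists exactly
of the edges and vertices in `A`. -/
def IsSegment (A : Set T.dual.Cell) (u v : T.dual.Vertex) (p : List D) : Prop :=
  T.dual.IsDiPath T.pos u v p ∧ (u :: p.map T.dual.head).Nodup ∧ T.dual.pathCells u p = A

end ThreeCellTemplate

/-! The topology of the sphere enters through linear algebra. Coboundaries of vertex functions and
of face functions are orthogonal subspaces of the alternating functions on darts, and by Euler's
formula their dimensions fill that space. So divergence-free flows have potentials, on vertices and
on faces (`IsSphere.exists_potential`, `IsSphere.exists_dual_potential`). For the cycle made of the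
two meridians, the face potential is constant on components of the complement but jumps across `WE`:
this is the Jordan-type separation `disjoint_W_E`. For a closed directed dual walk, the vertex
potential is monotone along the orientation; if the walk avoids some directed path from pole to
pole, the potential is constant and the walk is empty (`IsBipolar.dual_acyclic`). Hence both cores
are acyclic.

In a finite acyclic digraph it then suffices that sources and sinks are unique
(`IsBipolar.of_unique`). No face is bounded by a directed cycle, so its boundary has a vertex where
both adjacent boundary edges leave, and one where both enter. If a face of `W` receives no core
edge, one of the two edges at such a local source lies on `WE`; the direction condition at the
meridians then forces the vertex to be `N` and the face to be `NE` (`eq_NE_of_source`). The other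
three poles are found in the same way, with local sinks and `S` in the Eastern hemisphere.

A polar circle is the cyclic order of the darts at a pole. It crosses the meridians in exactly two
edges, which cut off the polar segment as an arc (`exists_dual_arc`). These two edges precede and
follow the segment and account for the 2 in the length bounds. The bridges are the duals of the
edges in the overlap condition. -/

namespace CMap

/-! ### Darts, incidences and duality. -/

section Basic

variable {D : Type*} (M : CMap D)

theorem tail_eq_tail_iff {d d' : D} : M.tail d = M.tail d' ↔ M.σ.SameCycle d d' :=
  Quotient.eq (r := Equiv.Perm.SameCycle.setoid M.σ)

theorem left_eq_left_iff {d d' : D} : M.left d = M.left d' ↔ M.φ.SameCycle d d' :=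
  Quotient.eq (r := Equiv.Perm.SameCycle.setoid M.φ)

theorem edge_eq_edge_iff {d d' : D} : M.edge d = M.edge d' ↔ d' = d ∨ d' = M.α d := by
  have h : M.edge d = M.edge d' ↔ M.α.SameCycle d d' :=
    Quotient.eq (r := Equiv.Perm.SameCycle.setoid M.α)
  have h2 : M.α ^ (2 : ℤ) = 1 := by
    ext x
    simp [zpow_ofNat, pow_two, M.α_invol]
  rw [h]
  constructor
  · rintro ⟨i, rfl⟩
    rcases Int.even_or_odd' i with ⟨k, rfl | rfl⟩
    · left; rw [zpow_mul, h2, one_zpow, Equiv.Perm.one_apply]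
    · right; rw [zpow_add, zpow_mul, h2, one_zpow, one_mul, zpow_one]
  · rintro (rfl | rfl)
    · exact .refl _ _
    · exact ⟨1, by simp⟩

@[simp]
theorem edge_α (d : D) : M.edge (M.α d) = M.edge d :=
  (M.edge_eq_edge_iff.2 (Or.inr rfl)).symm

@[simp]
theorem tail_α (d : D) : M.tail (M.α d) = M.head d := rfl

@[simp]
theorem head_α (d : D) : M.head (M.α d) = M.tail d := by
  rw [head, M.α_invol]

@[simp]
theorem left_α (d : D) : M.left (M.α d) = M.right d := rfl

@[simp]
theorem right_α (d : D) : M.right (M.α d) = M.left d := by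
  rw [right, M.α_invol]

theorem tail_σ (d : D) : M.tail (M.σ d) = M.tail d :=
  M.tail_eq_tail_iff.2 (Equiv.Perm.sameCycle_apply_left.2 (.refl _ _))

theorem left_φ (d : D) : M.left (M.φ d) = M.left d :=
  M.left_eq_left_iff.2 (Equiv.Perm.sameCycle_apply_left.2 (.refl _ _))

theorem tail_φ (d : D) : M.tail (M.φ d) = M.head d := by
  rw [head, ← M.tail_σ (M.φ d)]
  simp [φ]

theorem right_eq_left_σ_inv (d : D) : M.right d = M.left (M.σ⁻¹ d) := by
  rw [right, ← M.left_φ]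
  simp [φ, M.α_invol]

theorem right_σ (d : D) : M.right (M.σ d) = M.left d := by
  rw [right_eq_left_σ_inv]
  simp

theorem dual_left (d : D) : M.dual.left d = M.dualFace (M.head d) := by
  change _ = M.dual.left (M.α (M.α d))
  rw [M.α_invol]

theorem dualFace_injective : Function.Injective M.dualFace := by
  intro u v
  induction u using Quotient.inductionOn with | _ a
  induction v using Quotient.inductionOn with | _ b
  intro h
  have h' : M.dual.left (M.α a) = M.dual.left (M.α b) := h
  rw [left_eq_left_iff, dual_φ_eq, Equiv.Perm.sameCycle_conj] at h'
  exact M.tail_eq_tail_iff.2 (by simpa using h')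

theorem dualFace_surjective : Function.Surjective M.dualFace := by
  intro f
  induction f using Quotient.inductionOn with | _ a
  exact ⟨M.head a, (M.dual_left a).symm⟩

/-- Duality exchanges the vertex and face counts in Euler's formula, and `σ = α φ⁻¹` shows that the
dual permutations generate the same transitive group. -/
theorem dual_isSphere (h : M.IsSphere) : M.dual.IsSphere where
  nonempty := h.nonempty
  connected x y := by
    obtain ⟨g, hg, hxy⟩ := h.connected x y
    refine ⟨g, ?_, hxy⟩
    refine (Subgroup.closure_le _).2 ?_ hg
    have hα : M.α ∈ Subgroup.closure {M.φ, M.α} := Subgroup.subset_closure (by simp)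
    have hφ : M.φ ∈ Subgroup.closure {M.φ, M.α} := Subgroup.subset_closure (by simp)
    rintro _ (rfl | rfl)
    · have : M.σ = M.α * M.φ⁻¹ := by simp [φ]
      change M.σ ∈ Subgroup.closure {M.φ, M.α}
      rw [this]
      exact mul_mem hα (inv_mem hφ)
    · exact hα
  euler := by
    have h1 : Nat.card M.dual.Face = Nat.card M.Vertex :=
      (Nat.card_congr (Equiv.ofBijective _ ⟨M.dualFace_injective, M.dualFace_surjective⟩)).symm
    have h2 := h.euler
    change Nat.card M.Face + Nat.card M.dual.Face = Nat.card M.Edge + 2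
    omega

theorem IsSphere.eq_of_tail_eq_head {M : CMap D} (h : M.IsSphere) {R : Type*} (u : M.Vertex → R)
    (hu : ∀ d, u (M.tail d) = u (M.head d)) (v w : M.Vertex) : u v = u w := by
  have key : ∀ g ∈ Subgroup.closure {M.σ, M.α}, ∀ x, u (M.tail (g x)) = u (M.tail x) := by
    intro g hg
    induction hg using Subgroup.closure_induction with
    | mem g hg =>
      intro x
      rcases hg with rfl | rfl
      · rw [tail_σ]
      · rw [hu x, tail_α]
    | one => simp
    | mul g g' _ _ h h' => intro x; rw [Equiv.Perm.mul_apply, h, h']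
    | inv g _ h => intro x; rw [← h]; simp
  induction v using Quotient.inductionOn with | _ a
  induction w using Quotient.inductionOn with | _ b
  obtain ⟨g, hg, hab⟩ := h.connected a b
  have := key g hg a
  rw [hab] at this
  exact this.symm

end Basic

/-! ### Potentials: vanishing first cohomology by a dimension count. -/

section Potential

variable {D : Type*} (M : CMap D)

/-- The coboundary of a function on vertices. -/
def coboundary : (M.Vertex → ℚ) →ₗ[ℚ] (D → ℚ) where
  toFun h d := h (M.head d) - h (M.tail d)
  map_add' h h' := by ext d; simp only [Pi.add_apply]; ring
  map_smul' r h := by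
    ext d; simp only [Pi.smul_apply, smul_eq_mul, RingHom.id_apply]; ring

/-- The functions on darts which change sign when a dart is reversed. -/
def alternating : Submodule ℚ (D → ℚ) where
  carrier := {c | ∀ d, c (M.α d) = -c d}
  add_mem' h h' d := by simp only [Pi.add_apply, h d, h' d]; ring
  zero_mem' d := by simp
  smul_mem' r c h d := by simp [h d]

theorem range_coboundary_le : LinearMap.range M.coboundary ≤ M.alternating := by
  rintro _ ⟨h, rfl⟩ d
  simp [coboundary]

/-- An alternating function is determined by its value on one chosen dart of each edge. -/
theorem finrank_alternating_le [Finite D] : Module.finrank ℚ M.alternating ≤ Nat.card M.Edge := by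
  classical
  have := Fintype.ofFinite M.Edge
  let f : M.alternating →ₗ[ℚ] (M.Edge → ℚ) :=
    { toFun := fun c e => c.1 e.out
      map_add' := fun c c' => rfl
      map_smul' := fun r c => rfl }
  have hf : Function.Injective f := by
    rw [← LinearMap.ker_eq_bot, LinearMap.ker_eq_bot']
    rintro ⟨c, hc⟩ h0
    ext d
    have h1 : c (M.edge d).out = 0 := congrFun h0 (M.edge d)
    have h2 : M.edge (M.edge d).out = M.edge d := Quotient.out_eq _
    rcases M.edge_eq_edge_iff.1 h2 with h | h
    · change c d = 0
      rw [h, h1]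
    · change c d = 0
      rw [h, hc, h1, neg_zero]
  have := LinearMap.finrank_le_finrank_of_injective hf
  rwa [Module.finrank_pi, ← Nat.card_eq_fintype_card] at this

/-- Rank-nullity: by connectedness the kernel of the coboundary consists of constants. -/
theorem card_vertex_le_finrank [Finite D] (hM : M.IsSphere) :
    Nat.card M.Vertex ≤ Module.finrank ℚ (LinearMap.range M.coboundary) + 1 := by
  classical
  have := Fintype.ofFinite M.Vertex
  have h1 := LinearMap.finrank_range_add_finrank_ker M.coboundary
  rw [Module.finrank_pi, ← Nat.card_eq_fintype_card] at h1
  have h2 : Module.finrank ℚ (LinearMap.ker M.coboundary) ≤ 1 := by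
    refine (Submodule.finrank_mono (t := ℚ ∙ (fun _ => 1 : M.Vertex → ℚ)) ?_).trans
      ((finrank_span_le_card _).trans (by simp))
    intro h hh
    obtain ⟨d⟩ := hM.nonempty
    rw [Submodule.mem_span_singleton]
    refine ⟨h (M.tail d), ?_⟩
    ext v
    have : ∀ d, h (M.head d) - h (M.tail d) = 0 := fun d => congrFun hh d
    simp [hM.eq_of_tail_eq_head h (fun d => by linarith [this d]) v (M.tail d)]
  omega

/-- A coboundary telescopes to zero around each face; reindexing by `φ` performs this cancellation
for all faces at once. -/
theorem coboundary_dotProduct [Fintype D] (h : M.Vertex → ℚ) (u : M.Face → ℚ) :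
    M.coboundary h ⬝ᵥ M.dual.coboundary u = 0 := by
  have alt : ∀ d, M.coboundary h (M.α d) = - M.coboundary h d :=
    M.range_coboundary_le ⟨h, rfl⟩
  have h1 : ∑ d, M.coboundary h d * u (M.left d) = 0 := by
    simp only [coboundary, LinearMap.coe_mk, AddHom.coe_mk, sub_mul, Finset.sum_sub_distrib]
    rw [sub_eq_zero, ← Equiv.sum_comp M.φ (fun d => h (M.tail d) * u (M.left d))]
    simp only [tail_φ, left_φ]
  have h2 : ∑ d, M.coboundary h d * u (M.right d) = 0 := by
    rw [← Equiv.sum_comp M.α]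
    simp only [alt, right_α, neg_mul, Finset.sum_neg_distrib, h1, neg_zero]
  calc _ = ∑ d, (M.coboundary h d * u (M.right d) - M.coboundary h d * u (M.left d)) :=
        Finset.sum_congr rfl fun d _ => mul_sub _ _ _
    _ = 0 := by rw [Finset.sum_sub_distrib, h1, h2, sub_zero]

/-- The first cohomology of the sphere vanishes: an alternating function on darts whose sum over
every face vanishes is a coboundary. -/
theorem IsSphere.exists_potential {M : CMap D} [Fintype D] (hM : M.IsSphere) {c : D → ℚ}
    (hc : ∀ d, c (M.α d) = -c d) (hf : ∀ u : M.Face → ℚ, ∑ d, u (M.left d) * c d = 0) :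
    ∃ h : M.Vertex → ℚ, ∀ d, c d = h (M.head d) - h (M.tail d) := by
  classical
  set B := LinearMap.range M.coboundary
  set B' := LinearMap.range M.dual.coboundary
  have hdisj : B ⊓ B' = ⊥ := by
    rw [Submodule.eq_bot_iff]
    -- A common vector is orthogonal to itself, hence zero over `ℚ`.
    rintro _ ⟨⟨h, rfl⟩, ⟨u, hu⟩⟩
    have := M.coboundary_dotProduct h u
    rw [hu] at this
    exact dotProduct_self_eq_zero.1 this
  have hle : B ⊔ B' ≤ M.alternating := sup_le M.range_coboundary_le M.dual.range_coboundary_le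
  have hdim := Submodule.finrank_sup_add_finrank_inf_eq B B'
  rw [hdisj, finrank_bot] at hdim
  have h1 : Nat.card M.Vertex ≤ Module.finrank ℚ B + 1 := M.card_vertex_le_finrank hM
  have h2 : Nat.card M.Face ≤ Module.finrank ℚ B' + 1 :=
    M.dual.card_vertex_le_finrank (M.dual_isSphere hM)
  -- The dimensions add up to at least (V - 1) + (F - 1), which is E by Euler's formula.
  have heq : B ⊔ B' = M.alternating := by
    refine Submodule.eq_of_le_of_finrank_le hle ?_
    have := M.finrank_alternating_le
    have := hM.euler
    omega
  obtain ⟨_, ⟨h, rfl⟩, _, ⟨u, rfl⟩, hsum⟩ :=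
    Submodule.mem_sup.1 (heq ▸ (show c ∈ M.alternating from hc))
  have hr : ∑ d, u (M.right d) * c d = 0 := by
    rw [← Equiv.sum_comp M.α]
    simp only [right_α, hc, mul_neg, Finset.sum_neg_distrib, hf u, neg_zero]
  -- Vanishing face sums make `c` orthogonal to `B'`, so its `B'` component is orthogonal to itself
  -- and vanishes.
  have horth : M.dual.coboundary u ⬝ᵥ c = 0 := by
    calc _ = ∑ d, (u (M.right d) * c d - u (M.left d) * c d) :=
          Finset.sum_congr rfl fun d _ => sub_mul _ _ _
      _ = 0 := by rw [Finset.sum_sub_distrib, hr, zero_sub, neg_eq_zero]; exact hf u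
  have hor : M.coboundary h ⬝ᵥ M.dual.coboundary u = 0 := M.coboundary_dotProduct h u
  rw [← hsum, dotProduct_add, dotProduct_comm, hor, zero_add] at horth
  have h0 := dotProduct_self_eq_zero.1 horth
  rw [h0, add_zero] at hsum
  exact ⟨h, fun d => (congrFun hsum d).symm⟩

end Potential

end CMap

namespace CMap

variable {D : Type*} (M : CMap D)

/-! ### Directed walks and acyclic orientations. -/

section Paths

/-- There is a directed edge from `u` to `v`. -/
def Step (P : Set D) (u v : M.Vertex) : Prop := ∃ d ∈ P, M.tail d = u ∧ M.head d = v

variable {M} {P : Set D} {u v w : M.Vertex} {p q : List D}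

theorem Step.of_mem {d : D} (h : d ∈ P) : M.Step P (M.tail d) (M.head d) := ⟨d, h, rfl, rfl⟩

theorem isDiPath_append :
    M.IsDiPath P u v (p ++ q) ↔ ∃ w, M.IsDiPath P u w p ∧ M.IsDiPath P w v q := by
  induction p generalizing u with
  | nil => simp [IsDiPath]
  | cons d p ih => simp [IsDiPath, ih, and_assoc]

theorem IsDiPath.mem (h : M.IsDiPath P u v p) {d : D} (hd : d ∈ p) : d ∈ P := by
  induction p generalizing u with
  | nil => simp at hd
  | cons x p ih =>
    rcases List.mem_cons.1 hd with rfl | hd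
    · exact h.1
    · exact ih h.2.2 hd

theorem exists_isDiPath_of_transGen (h : Relation.TransGen (M.Step P) u v) :
    ∃ p, p ≠ [] ∧ M.IsDiPath P u v p := by
  induction h using Relation.TransGen.head_induction_on with
  | single h =>
    obtain ⟨d, hd, rfl, rfl⟩ := h
    exact ⟨[d], by simp, hd, rfl, rfl⟩
  | head h _ ih =>
    obtain ⟨d, hd, rfl, rfl⟩ := h
    obtain ⟨p, -, hp⟩ := ih
    exact ⟨d :: p, by simp, hd, rfl, hp⟩

theorem IsDiPath.transGen_tail {x : D} (h : M.IsDiPath P u v (x :: p)) {d : D} (hd : d ∈ p) :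
    Relation.TransGen (M.Step P) (M.tail x) (M.tail d) := by
  induction p generalizing u x with
  | nil => simp at hd
  | cons y p ih =>
    have h1 : Relation.TransGen (M.Step P) (M.tail x) (M.tail y) :=
      .single ⟨x, h.1, rfl, h.2.2.2.1.symm⟩
    rcases List.mem_cons.1 hd with rfl | hd
    · exact h1
    · exact h1.trans (ih h.2.2 hd)

theorem IsDiPath.transGen_head {x : D} (h : M.IsDiPath P u v (x :: p)) {d : D} (hd : d ∈ p) :
    Relation.TransGen (M.Step P) (M.head x) (M.head d) := by
  induction p generalizing u x with
  | nil => simp at hd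
  | cons y p ih =>
    have h1 : Relation.TransGen (M.Step P) (M.head x) (M.head y) :=
      .single ⟨y, h.2.2.1, h.2.2.2.1, rfl⟩
    rcases List.mem_cons.1 hd with rfl | hd
    · exact h1
    · exact h1.trans (ih h.2.2 hd)

theorem not_transGen_self (hP : ∀ u p, M.IsDiPath P u u p → p = []) (u : M.Vertex) :
    ¬ Relation.TransGen (M.Step P) u u := fun h => by
  obtain ⟨p, hp, h⟩ := exists_isDiPath_of_transGen h
  exact hp (hP u p h)

/-- The part of the walk between two darts with the same tail would be a directed cycle. -/
theorem IsDiPath.eq_of_tail_eq (hP : ∀ u p, M.IsDiPath P u u p → p = [])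
    (h : M.IsDiPath P u v p) {d d' : D} (hd : d ∈ p) (hd' : d' ∈ p) (ht : M.tail d = M.tail d') :
    d = d' := by
  induction p generalizing u with
  | nil => simp at hd
  | cons x p ih =>
    rcases List.mem_cons.1 hd with rfl | hd <;> rcases List.mem_cons.1 hd' with rfl | hd'
    · rfl
    · exact absurd (ht ▸ h.transGen_tail hd') (not_transGen_self hP _)
    · rename_i hd0
      exact absurd (ht ▸ h.transGen_tail hd0) (not_transGen_self hP _)
    · exact ih h.2.2 hd hd'

theorem IsDiPath.eq_of_head_eq (hP : ∀ u p, M.IsDiPath P u u p → p = [])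
    (h : M.IsDiPath P u v p) {d d' : D} (hd : d ∈ p) (hd' : d' ∈ p) (ht : M.head d = M.head d') :
    d = d' := by
  induction p generalizing u with
  | nil => simp at hd
  | cons x p ih =>
    rcases List.mem_cons.1 hd with rfl | hd <;> rcases List.mem_cons.1 hd' with rfl | hd'
    · rfl
    · exact absurd (ht ▸ h.transGen_head hd') (not_transGen_self hP _)
    · rename_i hd0
      exact absurd (ht ▸ h.transGen_head hd0) (not_transGen_self hP _)
    · exact ih h.2.2 hd hd'

theorem IsDiPath.tail_head (h : M.IsDiPath P u v p) (hp : p ≠ []) : M.tail (p.head hp) = u := by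
  cases p with
  | nil => simp at hp
  | cons x p => exact h.2.1

theorem IsDiPath.head_getLast (h : M.IsDiPath P u v p) (hp : p ≠ []) :
    M.head (p.getLast hp) = v := by
  obtain ⟨w, -, h2⟩ := isDiPath_append.1 ((List.dropLast_append_getLast hp).symm ▸ h)
  exact h2.2.2

theorem pathCells_vert_head {d : D} (hd : d ∈ p) : .vert (M.head d) ∈ M.pathCells u p :=
  Or.inr ⟨d, hd, Or.inr rfl⟩

theorem IsDiPath.pathCells_vert_tail (h : M.IsDiPath P u v p) {d : D} (hd : d ∈ p) :
    .vert (M.tail d) ∈ M.pathCells u p := by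
  obtain ⟨l, l', rfl⟩ := List.append_of_mem hd
  obtain ⟨w, h1, -, rfl, -⟩ := isDiPath_append.1 h
  rcases List.eq_nil_or_concat l with rfl | ⟨l, y, rfl⟩
  · exact Or.inl (congrArg _ h1.symm)
  · obtain ⟨w, -, -, -, h3⟩ := isDiPath_append.1 (List.concat_eq_append ▸ h1)
    rw [← h3]
    exact pathCells_vert_head (by simp)

theorem edge_mem_pathCells {d : D} : .edge (M.edge d) ∈ M.pathCells u p ↔ d ∈ p ∨ M.α d ∈ p := by
  constructor
  · rintro (h | ⟨x, hx, h | h⟩)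
    · cases h
    · rcases M.edge_eq_edge_iff.1 (Cell.edge.inj h) with rfl | rfl
      · exact Or.inl hx
      · exact Or.inr hx
    · cases h
  · rintro (h | h)
    · exact Or.inr ⟨d, h, Or.inl rfl⟩
    · exact Or.inr ⟨M.α d, h, Or.inl (by rw [edge_α])⟩

theorem wellFounded_step [Finite D] (hP : ∀ u p, M.IsDiPath P u u p → p = []) :
    WellFounded (M.Step P) := by
  have : IsTrans M.Vertex (Relation.TransGen (M.Step P)) := inferInstance
  have : Std.Irrefl (Relation.TransGen (M.Step P)) := ⟨not_transGen_self hP⟩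
  exact (Subrelation.wf (fun h => Relation.TransGen.single h)
    (Finite.wellFounded_of_trans_of_irrefl (Relation.TransGen (M.Step P))))

theorem wellFounded_swap_step [Finite D] (hP : ∀ u p, M.IsDiPath P u u p → p = []) :
    WellFounded (Function.swap (M.Step P)) := by
  have : IsTrans M.Vertex (Function.swap (Relation.TransGen (M.Step P))) :=
    ⟨fun _ _ _ h h' => h'.trans h⟩
  have : Std.Irrefl (Function.swap (Relation.TransGen (M.Step P))) := ⟨not_transGen_self hP⟩
  exact (Subrelation.wf (r := Function.swap (Relation.TransGen (M.Step P)))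
    (fun h => Relation.TransGen.single h)
    (Finite.wellFounded_of_trans_of_irrefl (Function.swap (Relation.TransGen (M.Step P)))))

/-- In a finite acyclic digraph, uniqueness of source and sink implies their existence. -/
theorem IsBipolar.of_unique [Finite D] {X : Set M.Vertex} {n s : M.Vertex}
    (acyclic : ∀ u p, M.IsDiPath P u u p → p = []) (hn : n ∈ X) (hs : s ∈ X)
    (hP : ∀ d ∈ P, M.tail d ∈ X ∧ M.head d ∈ X)
    (source : ∀ v ∈ X, (∀ d ∈ P, M.head d ≠ v) → v = n)
    (sink : ∀ v ∈ X, (∀ d ∈ P, M.tail d ≠ v) → v = s) : M.IsBipolar P X n s where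
  acyclic := acyclic
  north_mem := hn
  south_mem := hs
  source_iff v hv := by
    refine ⟨source v hv, ?_⟩
    rintro rfl d hd rfl
    -- Following edges backwards from any vertex of `X` ends at a source, which can only be the
    -- North pole, here `M.head d`. So `M.tail d` is reachable from `M.head d`, and `d` closes a
    -- cycle.
    have key : ∀ w, w ∈ X → Relation.ReflTransGen (M.Step P) (M.head d) w := by
      intro w hw
      induction w using (wellFounded_step acyclic).induction with | _ w ih
      by_cases h : ∀ d ∈ P, M.head d ≠ w
      · rw [source w hw h]
      · push Not at h
        obtain ⟨x, hx, rfl⟩ := h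
        exact (ih _ (.of_mem hx) (hP x hx).1).tail (.of_mem hx)
    exact not_transGen_self acyclic _ (.tail' (key _ (hP d hd).1) (.of_mem hd))
  sink_iff v hv := by
    refine ⟨sink v hv, ?_⟩
    rintro rfl d hd rfl
    have key : ∀ w, w ∈ X → Relation.ReflTransGen (M.Step P) w (M.tail d) := by
      intro w hw
      induction w using (wellFounded_swap_step acyclic).induction with | _ w ih
      by_cases h : ∀ d ∈ P, M.tail d ≠ w
      · rw [sink w hw h]
      · push Not at h
        obtain ⟨x, hx, rfl⟩ := h
        exact (ih _ (.of_mem hx) (hP x hx).2).head (.of_mem hx)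
    exact not_transGen_self acyclic _ (.head' (.of_mem hd) (key _ (hP d hd).2))

/-- A function which is nondecreasing along directed edges is bounded by its values at the poles. -/
theorem IsBipolar.monotone_bounds [Finite D] {n s : M.Vertex} (hb : M.IsBipolar P Set.univ n s)
    (h : M.Vertex → ℚ) (hh : ∀ d ∈ P, h (M.tail d) ≤ h (M.head d)) (v : M.Vertex) :
    h n ≤ h v ∧ h v ≤ h s := by
  constructor
  · induction v using (wellFounded_step hb.acyclic).induction with | _ w ih
    by_cases hw : ∀ d ∈ P, M.head d ≠ w
    · rw [(hb.source_iff w trivial).1 hw]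
    · push Not at hw
      obtain ⟨x, hx, rfl⟩ := hw
      exact (ih _ (.of_mem hx)).trans (hh x hx)
  · induction v using (wellFounded_swap_step hb.acyclic).induction with | _ w ih
    by_cases hw : ∀ d ∈ P, M.tail d ≠ w
    · rw [(hb.sink_iff w trivial).1 hw]
    · push Not at hw
      obtain ⟨x, hx, rfl⟩ := hw
      exact (hh x hx).trans (ih _ (.of_mem hx))

end Paths

/-! ### Flows of walks and the vanishing of first homology. -/

section Flow

open Classical in
/-- The number of times the walk `p` traverses `d`, minus the number of times it traverses the
reverse of `d`. -/
noncomputable def flow (p : List D) (d : D) : ℚ := p.count d - p.count (M.α d)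

theorem flow_α (p : List D) (d : D) : M.flow p (M.α d) = - M.flow p d := by
  rw [flow, flow, M.α_invol, neg_sub]

variable {M} {P : Set D} {u v : M.Vertex} {p : List D}

/-- Each traversed dart contributes the difference of `f` at its two ends, and the sum telescopes.
In particular, closed walks, and differences of walks with common ends, are divergence-free. -/
theorem sum_mul_flow [Fintype D] (h : M.IsDiPath P u v p) (f : M.Vertex → ℚ) :
    ∑ d, f (M.tail d) * M.flow p d = f u - f v := by
  classical
  induction p generalizing u with
  | nil =>
    obtain rfl : u = v := h
    simp [flow]
  | cons x p ih =>
    obtain ⟨-, rfl, h⟩ := h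
    have h1 : ∀ d, f (M.tail d) * M.flow (x :: p) d =
        (if x = d then f (M.tail d) else 0) - (if M.α x = d then f (M.tail d) else 0) +
          f (M.tail d) * M.flow p d := by
      intro d
      have h2 : x = M.α d ↔ M.α x = d :=
        ⟨fun h => by rw [h, M.α_invol], fun h => by rw [← h, M.α_invol]⟩
      simp only [flow, List.count_cons, beq_iff_eq, h2]
      split_ifs <;> push_cast <;> ring
    simp only [h1, Finset.sum_add_distrib, Finset.sum_sub_distrib, ih h, Finset.sum_ite_eq,
      Finset.mem_univ, if_true, tail_α]
    ring

theorem IsOrientation.flow_nonneg (hP : M.IsOrientation P) (hp : ∀ d ∈ p, d ∈ P) {d : D}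
    (hd : d ∈ P) : 0 ≤ M.flow p d := by
  classical
  have : M.α d ∉ p := fun h => (hP d).1 hd (hp _ h)
  simp [flow, List.count_eq_zero.2 this]

theorem IsOrientation.flow_pos (hP : M.IsOrientation P) (hp : ∀ d ∈ p, d ∈ P) {d : D}
    (hd : d ∈ p) : 0 < M.flow p d := by
  classical
  have : M.α d ∉ p := fun h => (hP d).1 (hp _ hd) (hp _ h)
  simpa [flow, List.count_eq_zero.2 this] using hd

theorem flow_eq_zero {d : D} (hd : d ∉ p) (hd' : M.α d ∉ p) : M.flow p d = 0 := by
  classical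
  simp [flow, List.count_eq_zero.2 hd, List.count_eq_zero.2 hd']

/-- The first homology of the sphere vanishes. -/
theorem IsSphere.exists_dual_potential {M : CMap D} [Fintype D] (hM : M.IsSphere) {c : D → ℚ}
    (hc : ∀ d, c (M.α d) = -c d) (hf : ∀ u : M.Vertex → ℚ, ∑ d, u (M.tail d) * c d = 0) :
    ∃ g : M.Face → ℚ, ∀ d, c d = g (M.right d) - g (M.left d) := by
  -- Faces of the dual are vertices, but the left one belongs to the head of the dart; reversing all
  -- darts turns the required sums into the assumed sums over tails.
  refine (M.dual_isSphere hM).exists_potential hc fun u => ?_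
  simp only [dual_left]
  rw [← Equiv.sum_comp M.α]
  simp only [head_α, hc, mul_neg, Finset.sum_neg_distrib, neg_eq_zero]
  exact hf fun v => u (M.dualFace v)

end Flow

end CMap

/-! ### Arcs and exits on cycles of a permutation. -/

/-- The arc from `a` to `c` on a cycle of a permutation. -/
theorem Equiv.Perm.SameCycle.exists_arc {D : Type*} [Finite D] {τ : Equiv.Perm D} {a c : D}
    (h : τ.SameCycle a c) (hne : a ≠ c) :
    ∃ m : ℕ, (τ ^ (m + 1)) a = c ∧ (∀ i ≤ m, (τ ^ i) a ≠ c) ∧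
      ∀ i ≤ m, ∀ j ≤ m, (τ ^ i) a = (τ ^ j) a → i = j := by
  classical
  have hex : ∃ n : ℕ, (τ ^ n) a = c := by
    obtain ⟨n, -, hn⟩ := h.exists_pow_eq'
    exact ⟨n, hn⟩
  obtain ⟨m, hm⟩ : ∃ m, Nat.find hex = m + 1 := Nat.exists_eq_succ_of_ne_zero fun h0 => by
    have := Nat.find_spec hex
    rw [h0] at this
    exact hne this
  have hmin : ∀ i ≤ m, (τ ^ i) a ≠ c := fun i hi => Nat.find_min hex (by omega)
  have hspec := Nat.find_spec hex
  rw [hm] at hspec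
  refine ⟨m, hspec, hmin, ?_⟩
  have key : ∀ i j, i < j → j ≤ m → (τ ^ i) a ≠ (τ ^ j) a := by
    intro i j hij hj he
    -- Cutting out the repetition between `i` and `j` would reach `c` before the first hitting time
    -- `m + 1`.
    refine hmin (m + 1 - j + i) (by omega) ?_
    rw [pow_add, Equiv.Perm.mul_apply, he, ← Equiv.Perm.mul_apply, ← pow_add,
      Nat.sub_add_cancel (by omega), hspec]
  intro i hi j hj he
  rcases lt_trichotomy i j with hij | hij | hij
  · exact absurd he (key i j hij hj)
  · exact hij
  · exact absurd he.symm (key j i hij hi)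

theorem Equiv.Perm.SameCycle.apply_eq {D R : Type*} [Finite D] {τ : Equiv.Perm D} {a c : D}
    (h : τ.SameCycle a c) (F : D → R) (hF : ∀ z, τ.SameCycle a z → F (τ z) = F z) : F c = F a := by
  obtain ⟨n, -, rfl⟩ := h.exists_pow_eq'
  clear h
  induction n with
  | zero => rfl
  | succ n ih => rw [pow_succ', Equiv.Perm.mul_apply, hF _ ⟨n, by simp⟩, ih]

/-- A cycle which meets a set and its complement leaves the set somewhere. -/
theorem Equiv.Perm.SameCycle.exists_exit {D : Type*} [Finite D] {τ : Equiv.Perm D} {a c : D}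
    (h : τ.SameCycle a c) (Q : D → Prop) (ha : Q a) (hc : ¬ Q c) :
    ∃ z, τ.SameCycle a z ∧ Q z ∧ ¬ Q (τ z) := by
  by_contra! hcon
  obtain ⟨n, -, rfl⟩ := h.exists_pow_eq'
  refine hc ?_
  clear h hc
  induction n with
  | zero => exact ha
  | succ n ih =>
    rw [pow_succ', Equiv.Perm.mul_apply]
    exact hcon _ ⟨n, by simp⟩ ih

/-! ### Components of the complement of a closed set of cells. -/

namespace CMap

variable {D : Type*} (M : CMap D)

/-- The dart `d` bounds, or lies at, the cell `x`. -/
def Incident (d : D) (x : M.Cell) : Prop :=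
  x = .vert (M.tail d) ∨ x = .edge (M.edge d) ∨ x = .face (M.left d)

variable {M} {A : Set M.Cell}

theorem Cell.Lt.exists_incident {x y : M.Cell} (h : Cell.Lt M x y) :
    ∃ d, M.Incident d x ∧ M.Incident d y := by
  cases h with
  | vert_edge d => exact ⟨d, by simp [Incident]⟩
  | edge_face d => exact ⟨d, by simp [Incident]⟩
  | vert_face d => exact ⟨d, by simp [Incident]⟩

theorem component_subset_compl {c x : M.Cell} (hc : c ∉ A) (hx : x ∈ M.component A c) : x ∉ A := by
  induction hx with
  | refl => exact hc
  | tail _ h _ => exact h.2.1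

theorem mem_component_iff_of_lt {c x y : M.Cell} (hx : x ∉ A) (hy : y ∉ A) (h : Cell.Lt M x y) :
    x ∈ M.component A c ↔ y ∈ M.component A c :=
  ⟨fun hc => hc.tail ⟨hx, hy, Or.inl h⟩, fun hc => hc.tail ⟨hy, hx, Or.inr h⟩⟩

theorem mem_component_comm {x y : M.Cell} (h : x ∈ M.component A y) : y ∈ M.component A x :=
  by
  induction h with
  | refl => exact .refl
  | tail _ h ih => exact ih.head ⟨h.2.1, h.1, h.2.2.symm⟩

theorem edge_mem_component_iff_left {c : M.Cell} (hA : ∀ f, .face f ∉ A) {d : D}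
    (hd : .edge (M.edge d) ∉ A) :
    .edge (M.edge d) ∈ M.component A c ↔ .face (M.left d) ∈ M.component A c :=
  mem_component_iff_of_lt hd (hA _) (.edge_face d)

theorem edge_mem_component_iff_right {c : M.Cell} (hA : ∀ f, .face f ∉ A) {d : D}
    (hd : .edge (M.edge d) ∉ A) :
    .edge (M.edge d) ∈ M.component A c ↔ .face (M.right d) ∈ M.component A c := by
  rw [← M.edge_α] at hd ⊢
  exact edge_mem_component_iff_left hA hd

/-- Two darts with the same tail bound a sector, whose faces are in the same component if no dart
strictly between them belongs to `A`. -/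
theorem left_mem_component_iff_right [Finite D] {c : M.Cell} (hA : ∀ f, .face f ∉ A) {x y : D}
    (hxy : M.tail x = M.tail y) (hne : x ≠ y)
    (h : ∀ z, M.tail z = M.tail x → .edge (M.edge z) ∈ A → z = x ∨ z = y) :
    .face (M.left x) ∈ M.component A c ↔ .face (M.right y) ∈ M.component A c := by
  obtain ⟨m, hm, hmin, hinj⟩ := (M.tail_eq_tail_iff.1 hxy).exists_arc hne
  -- Turning counter-clockwise from `x`, every dart strictly before `y` lies off `A` and joins the
  -- faces on its two sides.
  have key : ∀ i ≤ m, .face (M.left ((M.σ ^ i) x)) ∈ M.component A c ↔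
      .face (M.left x) ∈ M.component A c := by
    intro i hi
    induction i with
    | zero => rfl
    | succ i ih =>
      rw [← ih (by omega)]
      have h1 : .edge (M.edge ((M.σ ^ (i + 1)) x)) ∉ A := fun hz => by
        rcases h _ (M.tail_eq_tail_iff.2 ((Equiv.Perm.sameCycle_pow_left).2 (.refl _ _))) hz
          with h | h
        · exact absurd (hinj (i + 1) hi 0 (by omega) h) (by omega)
        · exact hmin _ hi h
      rw [← edge_mem_component_iff_left hA h1, edge_mem_component_iff_right hA h1, pow_succ',
        Equiv.Perm.mul_apply, right_σ]
  rw [← hm, pow_succ', Equiv.Perm.mul_apply, right_σ, key m le_rfl]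

/-- A function on faces which changes at most across edges of `A` is constant on components. -/
theorem eq_of_mem_component [Finite D] (hA : ∀ d, .edge (M.edge d) ∈ A → .vert (M.tail d) ∈ A)
    (g : M.Face → ℚ) (hg : ∀ d, .edge (M.edge d) ∉ A → g (M.right d) = g (M.left d))
    {f f' : M.Face} (hf : .face f ∉ A) (h : .face f' ∈ M.component A (.face f)) : g f' = g f := by
  -- All faces around a cell outside `A` carry the same value. For a vertex, one rotates by `σ`: by
  -- `hA` no edge there belongs to `A`.
  have const : ∀ x ∉ A, ∀ d d', M.Incident d x → M.Incident d' x →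
      g (M.left d') = g (M.left d) := by
    rintro x hx d d' (rfl | rfl | rfl) (h' | h' | h') <;>
      simp only [Cell.vert.injEq, Cell.edge.injEq, Cell.face.injEq, reduceCtorEq] at h'
    · refine (M.tail_eq_tail_iff.1 h').apply_eq (fun z => g (M.left z)) fun z hz => ?_
      have : M.tail (M.σ z) = M.tail d := by rw [tail_σ, M.tail_eq_tail_iff.2 hz]
      have h2 := hg (M.σ z) fun h => hx (this ▸ hA _ h)
      rw [right_σ] at h2
      exact h2.symm
    · rcases M.edge_eq_edge_iff.1 h' with rfl | rfl
      · rfl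
      · exact hg d hx
    · rw [h']
  suffices ∀ x ∈ M.component A (.face f), ∀ d, M.Incident d x → g (M.left d) = g f by
    induction f' using Quotient.inductionOn with | _ d
    exact this _ h d (by simp [Incident, left])
  intro x hx
  induction hx with
  | refl =>
    rintro d (h | h | h) <;> cases h
    rfl
  | tail _ h ih =>
    obtain ⟨d, hd, hd'⟩ : ∃ d, M.Incident d _ ∧ M.Incident d _ := by
      rcases h.2.2 with h | h
      · exact h.exists_incident
      · obtain ⟨d, h1, h2⟩ := h.exists_incident
        exact ⟨d, h2, h1⟩
    intro d' h'
    rw [const _ h.2.1 d d' hd' h', ih d hd]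

end CMap

/-! ### Sides of meridians, dual acyclicity and face boundaries. -/

namespace CMap

variable {D : Type*} {M : CMap D} {P : Set D} {n s u : M.Vertex} {p q : List D} {A : Set M.Cell}

theorem IsBipolar.head_ne (hb : M.IsBipolar P Set.univ n s) {d : D} (hd : d ∈ P) :
    M.head d ≠ n :=
  (hb.source_iff n trivial).2 rfl d hd

theorem IsBipolar.tail_ne (hb : M.IsBipolar P Set.univ n s) {d : D} (hd : d ∈ P) :
    M.tail d ≠ s :=
  (hb.sink_iff s trivial).2 rfl d hd

/-- At an inner vertex of one of two disjoint paths between the poles, the only edges of the two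
paths are those before and after the vertex. -/
theorem eq_or_eq_of_consecutive (hb : M.IsBipolar P Set.univ n s)
    (hp : M.IsDiPath P n s p) (hq : M.IsDiPath P n s q)
    (hdisj : M.pathCells n p ∩ M.pathCells n q ⊆ {.vert n, .vert s})
    {d d' z : D} (hd : d ∈ p) (hd' : d' ∈ p) (h : M.head d = M.tail d')
    (hz : M.tail z = M.head d) (hzA : .edge (M.edge z) ∈ M.pathCells n p ∪ M.pathCells n q) :
    z = M.α d ∨ z = d' := by
  have hv : .vert (M.head d) ∉ M.pathCells n q := fun hv => by
    rcases hdisj ⟨pathCells_vert_head hd, hv⟩ with h1 | h1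
    · exact hb.head_ne (hp.mem hd) (Cell.vert.inj h1)
    · exact hb.tail_ne (hp.mem hd') (h ▸ Cell.vert.inj h1)
  rcases hzA with hzA | hzA <;> rcases edge_mem_pathCells.1 hzA with h1 | h1
  · exact Or.inr (hp.eq_of_tail_eq hb.acyclic h1 hd' (hz.trans h))
  · left
    rw [hp.eq_of_head_eq hb.acyclic hd h1 (by rw [head_α, hz]), M.α_invol]
  · exact absurd (hz ▸ hq.pathCells_vert_tail h1) hv
  · refine absurd ?_ hv
    rw [← hz, ← M.head_α]
    exact pathCells_vert_head h1

/-- The faces on either side of one of two disjoint paths between the poles belong to the same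
component of the complement. -/
theorem side_mem_component_iff [Finite D] (hP : M.IsOrientation P)
    (hb : M.IsBipolar P Set.univ n s)
    (hp : M.IsDiPath P n s p) (hq : M.IsDiPath P n s q)
    (hdisj : M.pathCells n p ∩ M.pathCells n q ⊆ {.vert n, .vert s})
    (hA : A = M.pathCells n p ∪ M.pathCells n q) (hf : ∀ f, .face f ∉ A) {c : M.Cell}
    {d : D} (hd : d ∈ p) (hne : p ≠ []) :
    (.face (M.left d) ∈ M.component A c ↔ .face (M.left (p.head hne)) ∈ M.component A c) ∧
    (.face (M.right d) ∈ M.component A c ↔ .face (M.right (p.head hne)) ∈ M.component A c) := by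
  -- At the vertex between consecutive darts, `M.α d` and `d'` bound two sectors, one on each side
  -- of the path, and neither contains a further edge of `A`.
  have step : ∀ d ∈ p, ∀ d' ∈ p, M.head d = M.tail d' →
      (.face (M.left d') ∈ M.component A c ↔ .face (M.left d) ∈ M.component A c) ∧
      (.face (M.right d') ∈ M.component A c ↔ .face (M.right d) ∈ M.component A c) := by
    intro d hd d' hd' h
    have hne : M.α d ≠ d' := fun h => (hP d).1 (hp.mem hd) (h ▸ hp.mem hd')
    constructor
    · rw [left_mem_component_iff_right hf (y := M.α d) h.symm hne.symm, right_α]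
      intro z hz hzA
      exact (eq_or_eq_of_consecutive hb hp hq hdisj hd hd' h (hz.trans h.symm) (hA ▸ hzA)).symm
    · rw [← left_mem_component_iff_right hf (x := M.α d) h hne, left_α]
      intro z hz hzA
      exact eq_or_eq_of_consecutive hb hp hq hdisj hd hd' h hz (hA ▸ hzA)
  have key : ∀ (l : List D) (u : M.Vertex) (y : D), (∀ x ∈ y :: l, x ∈ p) →
      M.IsDiPath P u s (y :: l) → ∀ x ∈ y :: l,
      (.face (M.left x) ∈ M.component A c ↔ .face (M.left y) ∈ M.component A c) ∧
      (.face (M.right x) ∈ M.component A c ↔ .face (M.right y) ∈ M.component A c) := by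
    intro l
    induction l with
    | nil =>
      intro u y _ _ x hx
      rw [List.mem_singleton.1 hx]
      exact ⟨Iff.rfl, Iff.rfl⟩
    | cons y' l ih =>
      intro u y hsub hpath x hx
      rcases List.mem_cons.1 hx with rfl | hx
      · exact ⟨Iff.rfl, Iff.rfl⟩
      · have h1 := ih _ y' (fun x hx => hsub x (List.mem_cons_of_mem _ hx)) hpath.2.2 x hx
        have h2 := step y (hsub y (by simp)) y' (hsub y' (by simp)) hpath.2.2.2.1.symm
        exact ⟨h1.1.trans h2.1, h1.2.trans h2.2⟩
  cases p with
  | nil => simp at hd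
  | cons y l => exact key l n y (fun _ h => h) hp d hd

/-- A closed directed dual walk which avoids a directed path between the poles is trivial. -/
theorem IsBipolar.dual_acyclic [Finite D] (hM : M.IsSphere) (hP : M.IsOrientation P)
    (hb : M.IsBipolar P Set.univ n s) (hp : M.IsDiPath P n s p) {Q : Set D} (hQP : Q ⊆ P)
    (hQp : ∀ d ∈ p, d ∉ Q) {f : M.dual.Vertex} {r : List D} (hr : M.dual.IsDiPath Q f f r) :
    r = [] := by
  classical
  cases nonempty_fintype D
  have hrP : ∀ d ∈ r, d ∈ P := fun d hd => hQP (hr.mem hd)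
  -- The closed dual walk is divergence-free, so its flow has a potential `h`, a winding number. It
  -- never decreases along `P` and is constant along the uncrossed path `p`, so it takes equal
  -- values at the poles; `monotone_bounds` then makes it constant everywhere.
  obtain ⟨h, hh⟩ := hM.exists_potential (c := M.flow r) (M.flow_α r) fun u =>
    (sum_mul_flow hr u).trans (sub_self _)
  have hmono : ∀ d ∈ P, h (M.tail d) ≤ h (M.head d) := fun d hd => by
    linarith [hh d, hP.flow_nonneg hrP hd]
  have hconst : ∀ (l : List D) (u : M.Vertex), (∀ d ∈ l, d ∈ p) → M.IsDiPath P u s l →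
      h u = h s := by
    intro l
    induction l with
    | nil => rintro u - rfl; rfl
    | cons d l ih =>
      rintro u hl ⟨hd, rfl, hl'⟩
      rw [← ih _ (fun x hx => hl x (List.mem_cons_of_mem _ hx)) hl']
      have hdp := hl d (by simp)
      have h0 : M.flow r d = 0 := flow_eq_zero (fun hdr => hQp d hdp (hr.mem hdr))
        (fun hdr => (hP d).1 hd (hrP _ hdr))
      linarith [hh d]
  have hns := hconst p n (fun _ h => h) hp
  refine List.eq_nil_iff_forall_not_mem.2 fun d hd => ?_
  have h1 := hP.flow_pos hrP hd
  have h2 := hb.monotone_bounds h hmono (M.tail d)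
  have h3 := hb.monotone_bounds h hmono (M.head d)
  linarith [hh d]

/-- No face is bounded by a directed cycle. -/
theorem exists_left_eq [Finite D] (hP : M.IsOrientation P)
    (hac : ∀ u p, M.IsDiPath P u u p → p = []) (f : M.Face) :
    (∃ d ∈ P, M.left d = f) ∧ ∃ d ∉ P, M.left d = f := by
  induction f using Quotient.inductionOn with | _ d
  -- The exponent is a successor so that the circuit around the face is nonempty and contradicts
  -- acyclicity.
  have hper : ∃ k, (M.φ ^ (k + 1)) d = d := by
    refine ⟨orderOf M.φ - 1, ?_⟩
    rw [Nat.sub_add_cancel (orderOf_pos _), pow_orderOf_eq_one, Equiv.Perm.one_apply]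
  obtain ⟨k, hk⟩ := hper
  have hleft : ∀ i, M.left ((M.φ ^ i) d) = M.left d := fun i =>
    M.left_eq_left_iff.2 ((Equiv.Perm.sameCycle_pow_left).2 (.refl _ _))
  have tail_succ : ∀ i, M.tail ((M.φ ^ (i + 1)) d) = M.head ((M.φ ^ i) d) := fun i => by
    rw [pow_succ', Equiv.Perm.mul_apply, tail_φ]
  constructor
  · by_contra! hcon
    have hstep : ∀ i, M.Step P (M.tail ((M.φ ^ (i + 1)) d)) (M.tail ((M.φ ^ i) d)) := fun i => by
      have h1 : (M.φ ^ i) d ∉ P := fun h => hcon _ h (hleft i)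
      have h2 : M.α ((M.φ ^ i) d) ∈ P := by
        rw [hP]; rwa [M.α_invol]
      exact ⟨_, h2, by rw [tail_succ, tail_α], by rw [head_α]⟩
    have key : ∀ i, Relation.TransGen (M.Step P) (M.tail ((M.φ ^ (i + 1)) d)) (M.tail d) := by
      intro i
      induction i with
      | zero => exact .single (hstep 0)
      | succ i ih => exact .head (hstep _) ih
    exact not_transGen_self hac _ (hk ▸ key k)
  · by_contra! hcon
    have hstep : ∀ i, M.Step P (M.tail ((M.φ ^ i) d)) (M.tail ((M.φ ^ (i + 1)) d)) := fun i =>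
      ⟨(M.φ ^ i) d, by_contra fun h => hcon _ h (hleft i), rfl, (tail_succ i).symm⟩
    have key : ∀ i, Relation.TransGen (M.Step P) (M.tail d) (M.tail ((M.φ ^ (i + 1)) d)) := by
      intro i
      induction i with
      | zero => exact .single (hstep 0)
      | succ i ih => exact .tail ih (hstep _)
    have := key k
    rw [hk] at this
    exact not_transGen_self hac _ this

end CMap

/-! ### The hemispheres and their separation by the meridians. -/

namespace MeridianSphere

variable {D : Type*} (T : MeridianSphere D)

theorem face_notMem_meridians (f : T.Face) : .face f ∉ T.meridians := by
  rintro (h | h) <;> rcases h with h | ⟨_, _, h | h⟩ <;> cases h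

theorem edge_mem_meridians {d : D} : .edge (T.edge d) ∈ T.meridians ↔
    (d ∈ T.WE ∨ T.α d ∈ T.WE) ∨ (d ∈ T.EW ∨ T.α d ∈ T.EW) :=
  or_congr CMap.edge_mem_pathCells CMap.edge_mem_pathCells

theorem tail_mem_meridians {d : D} (h : .edge (T.edge d) ∈ T.meridians) :
    .vert (T.tail d) ∈ T.meridians := by
  rcases T.edge_mem_meridians.1 h with (h | h) | (h | h)
  · exact Or.inl (T.WE_path.pathCells_vert_tail h)
  · rw [← T.head_α]
    exact Or.inl (CMap.pathCells_vert_head h)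
  · exact Or.inr (T.EW_path.pathCells_vert_tail h)
  · rw [← T.head_α]
    exact Or.inr (CMap.pathCells_vert_head h)

theorem edge_ne_of_mem {d d' : D} (hd : d ∈ T.WE) (hd' : d' ∈ T.EW) : T.edge d ≠ T.edge d' := by
  intro h
  have h1 : .edge (T.edge d) ∈ T.pathCells T.N T.WE := CMap.edge_mem_pathCells.2 (Or.inl hd)
  have h2 : .edge (T.edge d) ∈ T.pathCells T.N T.EW := h ▸ CMap.edge_mem_pathCells.2 (Or.inl hd')
  rcases T.disjoint ⟨h1, h2⟩ with h | h <;> cases h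

theorem WE_head_ne_EW_head : T.WE.head T.WE_ne ≠ T.EW.head T.EW_ne := fun h =>
  T.edge_ne_of_mem (List.head_mem _) (List.head_mem _) (congrArg T.edge h)

theorem WE_getLast_ne_EW_getLast : T.WE.getLast T.WE_ne ≠ T.EW.getLast T.EW_ne := fun h =>
  T.edge_ne_of_mem (List.getLast_mem _) (List.getLast_mem _) (congrArg T.edge h)

theorem eq_head_of_tail_eq_N {z : D} (hz : T.tail z = T.N) (h : .edge (T.edge z) ∈ T.meridians) :
    z = T.WE.head T.WE_ne ∨ z = T.EW.head T.EW_ne := by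
  have ha := T.WE_path.tail_head T.WE_ne
  have hc := T.EW_path.tail_head T.EW_ne
  rcases T.edge_mem_meridians.1 h with (h | h) | (h | h)
  · exact Or.inl (T.WE_path.eq_of_tail_eq T.bipolar.acyclic h (List.head_mem _) (hz.trans ha.symm))
  · exact absurd ((T.head_α z).trans hz) (T.bipolar.head_ne (T.WE_path.mem h))
  · exact Or.inr (T.EW_path.eq_of_tail_eq T.bipolar.acyclic h (List.head_mem _) (hz.trans hc.symm))
  · exact absurd ((T.head_α z).trans hz) (T.bipolar.head_ne (T.EW_path.mem h))

theorem eq_getLast_of_head_eq_S {z : D} (hz : T.head z = T.S)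
    (h : .edge (T.edge z) ∈ T.meridians) :
    z = T.WE.getLast T.WE_ne ∨ z = T.EW.getLast T.EW_ne := by
  have ha := T.WE_path.head_getLast T.WE_ne
  have hc := T.EW_path.head_getLast T.EW_ne
  rcases T.edge_mem_meridians.1 h with (h | h) | (h | h)
  · exact Or.inl
      (T.WE_path.eq_of_head_eq T.bipolar.acyclic h (List.getLast_mem _) (hz.trans ha.symm))
  · exact absurd ((T.tail_α z).trans hz) (T.bipolar.tail_ne (T.WE_path.mem h))
  · exact Or.inr
      (T.EW_path.eq_of_head_eq T.bipolar.acyclic h (List.getLast_mem _) (hz.trans hc.symm))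
  · exact absurd ((T.tail_α z).trans hz) (T.bipolar.tail_ne (T.EW_path.mem h))

theorem tail_heads_eq : T.tail (T.WE.head T.WE_ne) = T.tail (T.EW.head T.EW_ne) :=
  (T.WE_path.tail_head T.WE_ne).trans (T.EW_path.tail_head T.EW_ne).symm

theorem notMem_meridians_of_mem_W {x : T.Cell} (h : x ∈ T.W) : x ∉ T.meridians :=
  CMap.component_subset_compl (T.face_notMem_meridians _) h

theorem notMem_meridians_of_mem_E {x : T.Cell} (h : x ∈ T.E) : x ∉ T.meridians :=
  CMap.component_subset_compl (T.face_notMem_meridians _) h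

variable [Finite D]

theorem right_mem_W {d : D} (hd : d ∈ T.WE) : .face (T.right d) ∈ T.W :=
  (CMap.side_mem_component_iff T.orientation T.bipolar T.WE_path T.EW_path T.disjoint rfl
    T.face_notMem_meridians hd T.WE_ne).2.2 .refl

theorem left_mem_E {d : D} (hd : d ∈ T.WE) : .face (T.left d) ∈ T.E :=
  (CMap.side_mem_component_iff T.orientation T.bipolar T.WE_path T.EW_path T.disjoint rfl
    T.face_notMem_meridians hd T.WE_ne).1.2 .refl

theorem side_EW_mem_component_iff {c : T.Cell} {d : D} (hd : d ∈ T.EW) :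
    (.face (T.left d) ∈ T.component T.meridians c ↔
      .face (T.left (T.EW.head T.EW_ne)) ∈ T.component T.meridians c) ∧
    (.face (T.right d) ∈ T.component T.meridians c ↔
      .face (T.right (T.EW.head T.EW_ne)) ∈ T.component T.meridians c) :=
  CMap.side_mem_component_iff T.orientation T.bipolar T.EW_path T.WE_path
    (by rw [Set.inter_comm]; exact T.disjoint) (Set.union_comm _ _)
    T.face_notMem_meridians hd T.EW_ne

/-- The sector at `N` counter-clockwise from the first edge of `EW` to that of `WE` contains no
meridian edge, so it joins the left side of `EW` to the right side of `WE`. The complementary sector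
serves `right_mem_E`. -/
theorem left_mem_W {d : D} (hd : d ∈ T.EW) : .face (T.left d) ∈ T.W := by
  refine (T.side_EW_mem_component_iff hd).1.2 ?_
  rw [CMap.left_mem_component_iff_right T.face_notMem_meridians T.tail_heads_eq.symm
    T.WE_head_ne_EW_head.symm]
  · exact .refl
  · intro z hz h
    exact (T.eq_head_of_tail_eq_N (hz.trans (T.EW_path.tail_head T.EW_ne)) h).symm

theorem right_mem_E {d : D} (hd : d ∈ T.EW) : .face (T.right d) ∈ T.E := by
  refine (T.side_EW_mem_component_iff hd).2.2 ?_
  rw [← CMap.left_mem_component_iff_right T.face_notMem_meridians T.tail_heads_eq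
    T.WE_head_ne_EW_head]
  · exact .refl
  · intro z hz h
    exact T.eq_head_of_tail_eq_N (hz.trans (T.WE_path.tail_head T.WE_ne)) h

/-- The two hemispheres are different components. -/
theorem disjoint_W_E : Disjoint T.W T.E := by
  rw [Set.disjoint_left]
  intro x hW hE
  cases nonempty_fintype D
  have h1 : .face (T.left (T.WE.head T.WE_ne)) ∈ T.W := hW.trans (CMap.mem_component_comm hE)
  -- The meridians have common ends, so `WE` minus `EW` is divergence-free. Its face potential `g`
  -- changes only across meridian edges, hence is constant on components, yet it jumps across the
  -- first edge of `WE`.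
  obtain ⟨g, hg⟩ := T.sphere.exists_dual_potential
    (c := fun d => T.flow T.WE d - T.flow T.EW d)
    (fun d => by rw [T.flow_α, T.flow_α]; ring) fun u => by
      simp only [mul_sub, Finset.sum_sub_distrib, CMap.sum_mul_flow T.WE_path,
        CMap.sum_mul_flow T.EW_path, sub_self]
  have h2 := CMap.eq_of_mem_component (fun _ => T.tail_mem_meridians) g (fun d hd => by
    have h0 : ¬ _ := fun h => hd (T.edge_mem_meridians.2 h)
    push Not at h0
    have := hg d
    rw [CMap.flow_eq_zero h0.1.1 h0.1.2, CMap.flow_eq_zero h0.2.1 h0.2.2] at this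
    linarith) (T.face_notMem_meridians _) h1
  set a := T.WE.head T.WE_ne with ha
  have haWE : a ∈ T.WE := List.head_mem _
  have h3 := hg a
  have h4 := T.orientation.flow_pos (fun d => T.WE_path.mem) haWE
  have h5 : T.flow T.EW a = 0 := CMap.flow_eq_zero
    (fun h => T.edge_ne_of_mem haWE h rfl) (fun h => T.edge_ne_of_mem haWE h (T.edge_α a).symm)
  linarith

end MeridianSphere

/-! ### Dual cells, dual circles and their arcs. -/

namespace CMap

variable {D : Type*} {M : CMap D} {A C : Set M.Cell}

theorem vert_mem_dualCell_image {f : M.Face} :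
    (Cell.vert f : M.dual.Cell) ∈ M.dualCell '' C ↔ .face f ∈ C := by
  constructor
  · rintro ⟨x | x | x, hx, h⟩ <;> cases h
    exact hx
  · exact fun h => ⟨_, h, rfl⟩

theorem edge_mem_dualCell_image {e : M.Edge} :
    (Cell.edge e : M.dual.Cell) ∈ M.dualCell '' C ↔ .edge e ∈ C := by
  constructor
  · rintro ⟨x | x | x, hx, h⟩ <;> cases h
    exact hx
  · exact fun h => ⟨_, h, rfl⟩

theorem face_mem_dualCell_image {v : M.Vertex} :
    (Cell.face (M.dualFace v) : M.dual.Cell) ∈ M.dualCell '' C ↔ .vert v ∈ C := by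
  constructor
  · rintro ⟨x | x | x, hx, h⟩
    · rwa [← M.dualFace_injective (Cell.face.inj h)]
    · cases h
    · cases h
  · exact fun h => ⟨_, h, rfl⟩

/-- A face all of whose boundary edges belong to `A` is a component of the complement of `A`. -/
theorem component_eq_singleton (hA : ∀ d, .edge (M.edge d) ∈ A → .vert (M.tail d) ∈ A)
    {c : M.Cell} {f : M.Face} (hf : .face f ∈ M.component A c)
    (h : ∀ d, M.left d = f → .edge (M.edge d) ∈ A) : M.component A c = {.face f} := by
  refine Set.Subset.antisymm (fun x hx => ?_) (by simpa using hf)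
  have hx' : x ∈ M.component A (.face f) := (mem_component_comm hf).trans hx
  clear hx
  induction hx' with
  | refl => rfl
  | tail _ h' ih =>
    obtain rfl := ih
    exfalso
    rcases h' with ⟨-, hy, h' | h'⟩
    · cases h'
    · generalize hx : Cell.face f = x at h'
      cases h' with
      | vert_edge d => cases hx
      | edge_face d => exact hy (h d (Cell.face.inj hx).symm)
      | vert_face d => exact hy (hA d (h d (Cell.face.inj hx).symm))

theorem faceBoundary_dualFace (v : M.Vertex) : M.dual.faceBoundary (M.dualFace v) =
    {x | ∃ d, M.head d = v ∧ (x = .edge (M.dual.edge d) ∨ x = .vert (M.dual.tail d))} := by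
  ext x
  constructor
  · intro h
    change Cell.Lt M.dual x (.face (M.dualFace v)) at h
    generalize hy : Cell.face (M.dualFace v) = y at h
    cases h with
    | vert_edge d => cases hy
    | edge_face d =>
      refine ⟨d, ?_, Or.inl rfl⟩
      exact M.dualFace_injective ((M.dual_left d).symm.trans (Cell.face.inj hy).symm)
    | vert_face d =>
      refine ⟨d, ?_, Or.inr rfl⟩
      exact M.dualFace_injective ((M.dual_left d).symm.trans (Cell.face.inj hy).symm)
  · rintro ⟨d, rfl, rfl | rfl⟩
    · rw [← dual_left]
      exact Cell.Lt.edge_face d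
    · rw [← dual_left]
      exact Cell.Lt.vert_face d

theorem faceBoundary_dualFace_eq_tail (v : M.Vertex) : M.dual.faceBoundary (M.dualFace v) =
    {x | ∃ d, M.tail d = v ∧ (x = .edge (M.dual.edge d) ∨ x = .vert (M.dual.tail d))} := by
  rw [faceBoundary_dualFace]
  ext x
  constructor
  · rintro ⟨d, rfl, rfl | rfl⟩
    · exact ⟨M.α d, rfl, Or.inl (congrArg _ (M.dual.edge_α d).symm)⟩
    · exact ⟨M.φ d, M.tail_φ d, Or.inr (congrArg _ (M.left_φ d).symm)⟩
  · rintro ⟨d, rfl, rfl | rfl⟩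
    · exact ⟨M.α d, M.head_α d, Or.inl (congrArg _ (M.dual.edge_α d).symm)⟩
    · refine ⟨M.φ⁻¹ d, ?_, Or.inr (congrArg _ ?_)⟩
      · rw [← M.tail_φ]
        simp
      · have h := M.left_φ (M.φ⁻¹ d)
        rw [show M.φ (M.φ⁻¹ d) = d by simp] at h
        exact h

theorem IsDiPath.map_tail_append {P : Set D} {u v : M.Vertex} {p : List D}
    (h : M.IsDiPath P u v p) : p.map M.tail ++ [v] = u :: p.map M.head := by
  induction p generalizing u with
  | nil => simpa [IsDiPath] using (show u = v from h).symm
  | cons x p ih =>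
    obtain ⟨-, rfl, h⟩ := h
    simp [ih h]

theorem vert_mem_pathCells {u v : M.Vertex} {p : List D} :
    .vert v ∈ M.pathCells u p ↔ v ∈ u :: p.map M.head := by
  constructor
  · rintro (h | ⟨d, hd, h | h⟩)
    · rw [Cell.vert.inj h]
      simp
    · cases h
    · rw [Cell.vert.inj h]
      exact List.mem_cons_of_mem _ (List.mem_map_of_mem hd)
  · intro h
    rcases List.mem_cons.1 h with rfl | h
    · exact Or.inl rfl
    · obtain ⟨d, hd, rfl⟩ := List.mem_map.1 h
      exact pathCells_vert_head hd

/-- An orientation selects one dart per edge, so distinct selected darts have distinct edges. -/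
theorem IsOrientation.length_le_ncard [Finite D] {P : Set D} (hP : M.IsOrientation P) {l : List D}
    (hl : l.Nodup) (hlP : ∀ d ∈ l, d ∈ P) {B : Set M.Edge} (hB : ∀ d ∈ l, M.edge d ∈ B) :
    l.length ≤ B.ncard := by
  classical
  have h1 : (l.map M.edge).Nodup := hl.map_on fun x hx y hy h => by
    rcases M.edge_eq_edge_iff.1 h with h | h
    · exact h.symm
    · exact absurd (h ▸ hlP y hy) ((hP x).1 (hlP x hx))
  have h2 := List.toFinset_card_of_nodup h1
  rw [List.length_map] at h2
  rw [← h2, ← Set.ncard_coe_finset]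
  refine Set.ncard_le_ncard (fun e he => ?_) (Set.toFinite _)
  simp only [List.coe_toFinset, List.mem_map, Set.mem_ofPred_eq] at he
  obtain ⟨d, hd, rfl⟩ := he
  exact hB d hd

/-- The arc from `a` to `c` on a directed dual circle, given by the cycle of `a` under `τ`, consists
exactly of the cells of the circle in the region `C`, if the circle crosses the boundary of the
region at `a` and `c` only. -/
theorem exists_dual_arc [Finite D] {P : Set D} {τ : Equiv.Perm D}
    (hτ : ∀ d, M.right d = M.left (τ d)) {a c : D} (hac : τ.SameCycle a c) (hne : a ≠ c)
    (hP : ∀ d, τ.SameCycle a d → d ∈ P)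
    (hinj : ∀ d d', τ.SameCycle a d → τ.SameCycle a d' → M.left d = M.left d' → d = d')
    (ha : .face (M.right a) ∈ C) (hc : .face (M.right c) ∉ C)
    (hae : .edge (M.edge a) ∉ C) (hce : .edge (M.edge c) ∉ C)
    (hl : ∀ d, τ.SameCycle a d → d ≠ a → d ≠ c →
      (.edge (M.edge d) ∈ C ↔ .face (M.left d) ∈ C))
    (hr : ∀ d, τ.SameCycle a d → d ≠ a → d ≠ c →
      (.edge (M.edge d) ∈ C ↔ .face (M.right d) ∈ C)) :
    ∃ p : List D, M.dual.IsDiPath P (M.right a) (M.left c) p ∧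
      ((M.right a :: p.map M.right : List M.Face)).Nodup ∧ (a :: p ++ [c]).Nodup ∧
      (∀ d ∈ p, τ.SameCycle a d) ∧
      M.dual.pathCells (M.right a) p = M.dualCell '' C ∩ {x | ∃ d, τ.SameCycle a d ∧
        (x = .edge (M.dual.edge d) ∨ x = .vert (M.dual.tail d))} := by
  -- The cycle is cut into two arcs: `m + 1` darts from `a` to just before `c`, and `m' + 1` darts
  -- from `c` to just before `a`.
  obtain ⟨m, hm, hmin, hmi⟩ := hac.exists_arc hne
  obtain ⟨m', hm', hmin', hmi'⟩ := hac.symm.exists_arc hne.symm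
  have horb : ∀ i : ℕ, τ.SameCycle a ((τ ^ i) a) := fun i => ⟨i, by simp⟩
  have horb' : ∀ i : ℕ, τ.SameCycle a ((τ ^ i) c) := fun i => hac.trans ⟨i, by simp⟩
  have hsucc : ∀ (x : D) (i : ℕ), M.left ((τ ^ (i + 1)) x) = M.right ((τ ^ i) x) := fun x i => by
    rw [hτ, pow_succ', Equiv.Perm.mul_apply]
  have hmid : ∀ i, i + 1 ≤ m → (τ ^ (i + 1)) a ≠ a ∧ (τ ^ (i + 1)) a ≠ c := fun i hi =>
    ⟨fun h => absurd (hmi (i + 1) hi 0 (by omega) h) (by omega), hmin _ hi⟩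
  have hmid' : ∀ i, i + 1 ≤ m' → (τ ^ (i + 1)) c ≠ a ∧ (τ ^ (i + 1)) c ≠ c := fun i hi =>
    ⟨hmin' _ hi, fun h => absurd (hmi' (i + 1) hi 0 (by omega) h) (by omega)⟩
  -- Away from the cuts, a dart's edge and its two faces lie in `C` together or not at all, and the
  -- right face of one dart is the left face of the next; so membership propagates along each arc.
  have hin : ∀ i ≤ m, .face (M.right ((τ ^ i) a)) ∈ C := by
    intro i hi
    induction i with
    | zero => exact ha
    | succ i ih =>
      rw [← hr _ (horb _) (hmid i hi).1 (hmid i hi).2, hl _ (horb _) (hmid i hi).1 (hmid i hi).2,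
        hsucc]
      exact ih (by omega)
  have hout : ∀ i ≤ m', .face (M.right ((τ ^ i) c)) ∉ C := by
    intro i hi
    induction i with
    | zero => exact hc
    | succ i ih =>
      rw [← hr _ (horb' _) (hmid' i hi).1 (hmid' i hi).2,
        hl _ (horb' _) (hmid' i hi).1 (hmid' i hi).2, hsucc]
      exact ih (by omega)
  have hcover : ∀ d, τ.SameCycle a d → (∃ i ≤ m, d = (τ ^ i) a) ∨ ∃ i ≤ m', d = (τ ^ i) c := by
    intro d hd
    obtain ⟨k, rfl⟩ := hd.exists_nat_pow_eq
    clear hd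
    induction k with
    | zero => exact Or.inl ⟨0, by omega, rfl⟩
    | succ k ih =>
      rw [pow_succ', Equiv.Perm.mul_apply]
      rcases ih with ⟨i, hi, h⟩ | ⟨i, hi, h⟩
      · rw [h, ← Equiv.Perm.mul_apply, ← pow_succ']
        rcases hi.eq_or_lt with rfl | hi
        · exact Or.inr ⟨0, by omega, hm⟩
        · exact Or.inl ⟨i + 1, hi, rfl⟩
      · rw [h, ← Equiv.Perm.mul_apply, ← pow_succ']
        rcases hi.eq_or_lt with rfl | hi
        · exact Or.inl ⟨0, by omega, hm'⟩
        · exact Or.inr ⟨i + 1, hi, rfl⟩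
  -- The path uses the powers 1 to `m`, since the cut edge `a` is not part of it; putting `a` in
  -- front restores the power 0.
  have hlist : a :: (List.range m).map (fun i => (τ ^ (i + 1)) a) =
      (List.range (m + 1)).map (fun i => (τ ^ i) a) := by
    rw [List.range_succ_eq_map, List.map_cons, List.map_map]
    rfl
  refine ⟨(List.range m).map (fun i => (τ ^ (i + 1)) a), ?_, ?_, ?_, ?_, ?_⟩
  · have key : ∀ k, M.dual.IsDiPath P (M.right a) (M.left ((τ ^ (k + 1)) a))
        ((List.range k).map (fun i => (τ ^ (i + 1)) a)) := by
      intro k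
      induction k with
      | zero => exact hτ a
      | succ k ih =>
        rw [List.range_succ, List.map_append]
        exact isDiPath_append.2 ⟨_, ih, hP _ (horb _), rfl, (hsucc a (k + 1)).symm⟩
    have := key m
    rwa [hm] at this
  · rw [← List.map_cons, hlist, List.map_map]
    refine (List.nodup_range).map_on fun i hi j hj h => ?_
    simp only [List.mem_range] at hi hj
    simp only [Function.comp_apply, ← hsucc] at h
    have h1 := hinj _ _ (horb _) (horb _) h
    rw [pow_succ', pow_succ', Equiv.Perm.mul_apply, Equiv.Perm.mul_apply] at h1
    exact hmi i (by omega) j (by omega) (τ.injective h1)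
  · rw [hlist, List.nodup_append]
    refine ⟨(List.nodup_range).map_on fun i hi j hj h => ?_, by simp, ?_⟩
    · simp only [List.mem_range] at hi hj
      exact hmi i (by omega) j (by omega) h
    · intro x hx y hy
      obtain ⟨i, hi, rfl⟩ := List.mem_map.1 hx
      rw [List.mem_singleton.1 hy]
      simp only [List.mem_range] at hi
      exact hmin i (by omega)
  · intro d hd
    obtain ⟨i, -, rfl⟩ := List.mem_map.1 hd
    exact horb _
  · have hmem : ∀ i, i + 1 ≤ m →
        (τ ^ (i + 1)) a ∈ (List.range m).map (fun i => (τ ^ (i + 1)) a) := fun i hi =>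
      List.mem_map.2 ⟨i, List.mem_range.2 (by omega), rfl⟩
    have hvert : ∀ i ≤ m, ∀ f : M.Face, f = M.right ((τ ^ i) a) → .vert f ∈ M.dual.pathCells (M.right a)
        ((List.range m).map (fun i => (τ ^ (i + 1)) a)) := by
      rintro i hi _ rfl
      cases i with
      | zero => exact Or.inl rfl
      | succ i => exact Or.inr ⟨_, hmem i hi, Or.inr rfl⟩
    ext x
    constructor
    · rintro (rfl | ⟨d, hd, h⟩)
      · exact ⟨vert_mem_dualCell_image.2 ha, τ a, horb 1, Or.inr (congrArg _ (hτ a))⟩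
      · obtain ⟨i, hi, rfl⟩ := List.mem_map.1 hd
        rw [List.mem_range] at hi
        rcases h with rfl | rfl
        · refine ⟨edge_mem_dualCell_image.2 ?_, _, horb (i + 1), Or.inl rfl⟩
          exact (hr _ (horb _) (hmid i hi).1 (hmid i hi).2).2 (hin _ hi)
        · refine ⟨vert_mem_dualCell_image.2 (hin _ hi), _, horb (i + 1 + 1), Or.inr ?_⟩
          exact congrArg _ (hsucc a (i + 1)).symm
    · rintro ⟨hx, d, hd, rfl | rfl⟩
      · replace hx := edge_mem_dualCell_image.1 hx
        rcases hcover d hd with ⟨i, hi, rfl⟩ | ⟨i, hi, rfl⟩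
        · cases i with
          | zero => exact absurd hx hae
          | succ i => exact Or.inr ⟨_, hmem i hi, Or.inl rfl⟩
        · cases i with
          | zero => exact absurd hx hce
          | succ i =>
            exact absurd ((hr _ (horb' _) (hmid' i hi).1 (hmid' i hi).2).1 hx) (hout _ hi)
      · replace hx := vert_mem_dualCell_image.1 hx
        change Cell.face (M.left d) ∈ C at hx
        rcases hcover d hd with ⟨i, hi, rfl⟩ | ⟨i, hi, rfl⟩
        · cases i with
          | zero =>
            -- The left face of `a` is the right face of the last dart of the outer arc.
            refine absurd hx ?_
            rw [pow_zero, Equiv.Perm.one_apply, ← hm', hsucc]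
            exact hout _ le_rfl
          | succ i => exact hvert i (by omega) _ (hsucc a i)
        · cases i with
          | zero => exact hvert m le_rfl _ ((congrArg M.left hm.symm).trans (hsucc a m))
          | succ i =>
            rw [hsucc] at hx
            exact absurd hx (hout i (by omega))

end CMap

/-! ### Sources and sinks of the cores. -/

namespace ThreeCellTemplate

variable {D : Type*} (T : ThreeCellTemplate D)

theorem α_mem_pos {d : D} (h : d ∉ T.pos) : T.α d ∈ T.pos := by
  rw [T.orientation]
  rwa [T.α_invol]

theorem α_notMem_pos {d : D} (h : d ∈ T.pos) : T.α d ∉ T.pos :=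
  (T.orientation d).1 h

theorem eq_pole_of_mem_both {v : T.Vertex} (h : .vert v ∈ T.pathCells T.N T.WE)
    (h' : .vert v ∈ T.pathCells T.N T.EW) : v = T.N ∨ v = T.S :=
  (T.disjoint ⟨h, h'⟩).imp CMap.Cell.vert.inj CMap.Cell.vert.inj

theorem edge_mem_W_iff_left {d : D} (h : .edge (T.edge d) ∉ T.meridians) :
    .edge (T.edge d) ∈ T.W ↔ .face (T.left d) ∈ T.W :=
  CMap.edge_mem_component_iff_left T.face_notMem_meridians h

theorem edge_mem_W_iff_right {d : D} (h : .edge (T.edge d) ∉ T.meridians) :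
    .edge (T.edge d) ∈ T.W ↔ .face (T.right d) ∈ T.W :=
  CMap.edge_mem_component_iff_right T.face_notMem_meridians h

theorem edge_mem_E_iff_left {d : D} (h : .edge (T.edge d) ∉ T.meridians) :
    .edge (T.edge d) ∈ T.E ↔ .face (T.left d) ∈ T.E :=
  CMap.edge_mem_component_iff_left T.face_notMem_meridians h

theorem edge_mem_E_iff_right {d : D} (h : .edge (T.edge d) ∉ T.meridians) :
    .edge (T.edge d) ∈ T.E ↔ .face (T.right d) ∈ T.E :=
  CMap.edge_mem_component_iff_right T.face_notMem_meridians h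

/-- A bipolar core whose poles coincide is a singleton. -/
theorem core_eq_singleton {c : T.Cell} {f : T.Face}
    (hf : .face f ∈ T.component T.meridians c)
    (hb : T.IsCoreBipolar (T.dualCell '' T.component T.meridians c) f f) :
    T.dualCell '' T.component T.meridians c = {.vert f} := by
  have hv := CMap.vert_mem_dualCell_image.2 hf
  rw [CMap.component_eq_singleton (fun d => T.tail_mem_meridians) hf, Set.image_singleton]
  · rfl
  rintro d rfl
  -- A boundary edge of `f` off the meridians would be a core edge leaving or entering `f`, which is
  -- both source and sink.
  by_contra hm
  have hd := (CMap.edge_mem_component_iff_left T.face_notMem_meridians hm).2 hf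
  by_cases hp : d ∈ T.pos
  · exact (hb.sink_iff _ hv).2 rfl d ⟨hp, CMap.edge_mem_dualCell_image.2 hd⟩ rfl
  · refine (hb.source_iff _ hv).2 rfl (T.α d)
      ⟨T.α_mem_pos hp, CMap.edge_mem_dualCell_image.2 ?_⟩ (T.right_α d)
    change CMap.Cell.edge (T.edge (T.α d)) ∈ _
    rwa [T.edge_α]

variable [Finite D]

theorem notMem_E {x : T.Cell} (h : x ∈ T.W) : x ∉ T.E :=
  Set.disjoint_left.1 T.disjoint_W_E h

theorem NE_mem_W : .face T.NE ∈ T.W := T.right_mem_W (List.head_mem _)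

theorem NW_mem_W : .face T.NW ∈ T.W := T.left_mem_W (List.head_mem _)

theorem SE_mem_E : .face T.SE ∈ T.E := T.right_mem_E (List.getLast_mem _)

theorem SW_mem_E : .face T.SW ∈ T.E := T.left_mem_E (List.getLast_mem _)

theorem mem_WE_of_left_mem_E {d : D} (hd : d ∈ T.pos) (hf : .face (T.left d) ∈ T.E)
    (h : .edge (T.edge d) ∈ T.meridians) : d ∈ T.WE := by
  rcases T.edge_mem_meridians.1 h with (h | h) | (h | h)
  · exact h
  · exact absurd (T.WE_path.mem h) (T.α_notMem_pos hd)
  · exact absurd hf (T.notMem_E (T.left_mem_W h))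
  · exact absurd (T.EW_path.mem h) (T.α_notMem_pos hd)

theorem mem_EW_of_left_mem_W {d : D} (hd : d ∈ T.pos) (hf : .face (T.left d) ∈ T.W)
    (h : .edge (T.edge d) ∈ T.meridians) : d ∈ T.EW := by
  rcases T.edge_mem_meridians.1 h with (h | h) | (h | h)
  · exact absurd (T.left_mem_E h) (T.notMem_E hf)
  · exact absurd (T.WE_path.mem h) (T.α_notMem_pos hd)
  · exact h
  · exact absurd (T.EW_path.mem h) (T.α_notMem_pos hd)

theorem mem_WE_of_right_mem_W {d : D} (hd : d ∈ T.pos) (hf : .face (T.right d) ∈ T.W)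
    (h : .edge (T.edge d) ∈ T.meridians) : d ∈ T.WE := by
  rcases T.edge_mem_meridians.1 h with (h | h) | (h | h)
  · exact h
  · exact absurd (T.WE_path.mem h) (T.α_notMem_pos hd)
  · exact absurd (T.right_mem_E h) (T.notMem_E hf)
  · exact absurd (T.EW_path.mem h) (T.α_notMem_pos hd)

theorem mem_EW_of_right_mem_E {d : D} (hd : d ∈ T.pos) (hf : .face (T.right d) ∈ T.E)
    (h : .edge (T.edge d) ∈ T.meridians) : d ∈ T.EW := by
  rcases T.edge_mem_meridians.1 h with (h | h) | (h | h)
  · exact absurd hf (T.notMem_E (T.right_mem_W h))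
  · exact absurd (T.WE_path.mem h) (T.α_notMem_pos hd)
  · exact h
  · exact absurd (T.EW_path.mem h) (T.α_notMem_pos hd)

/-- Take a boundary vertex of `f` where both boundary edges, `T.α z` and `T.φ z`, leave. No core
edge enters `f`, so `T.α z` lies on `WE`. At a nonpolar vertex, `T.φ z` would either lie on `EW`,
against disjointness, or be an edge of `W` leaving the meridian, against `west_edges`. So the vertex
is `N`. -/
theorem eq_NE_of_source {f : T.Face} (hf : .face f ∈ T.W)
    (h : ∀ d ∈ T.pos, .edge (T.edge d) ∈ T.W → T.right d ≠ f) : f = T.NE := by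
  obtain ⟨⟨y, hy, hyf⟩, x, hx, rfl⟩ := CMap.exists_left_eq T.orientation T.bipolar.acyclic f
  obtain ⟨z, hxz, hz, hw⟩ := (T.left_eq_left_iff.1 hyf.symm).exists_exit (· ∉ T.pos) hx
    (not_not.2 hy)
  rw [not_not] at hw
  rw [T.left_eq_left_iff.2 hxz, ← T.right_α] at hf h ⊢
  have hz' := T.α_mem_pos hz
  have hzm : .edge (T.edge (T.α z)) ∈ T.meridians := by
    by_contra hm
    exact h _ hz' ((T.edge_mem_W_iff_right hm).2 hf) rfl
  have hzWE := T.mem_WE_of_right_mem_W hz' hf hzm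
  have hv : T.tail (T.φ z) = T.tail (T.α z) := T.tail_φ z
  have hWE := T.WE_path.pathCells_vert_tail hzWE
  rw [← hv] at hWE
  have hwf : .face (T.left (T.φ z)) ∈ T.W := by rwa [T.left_φ, ← T.right_α]
  have hS := T.bipolar.tail_ne hw
  by_cases hN : T.tail (T.φ z) = T.N
  · rw [T.WE_path.eq_of_tail_eq T.bipolar.acyclic hzWE (List.head_mem T.WE_ne)
      ((hv.symm.trans hN).trans (T.WE_path.tail_head T.WE_ne).symm)]
    rfl
  exfalso
  by_cases hm : .edge (T.edge (T.φ z)) ∈ T.meridians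
  · have := T.EW_path.pathCells_vert_tail (T.mem_EW_of_left_mem_W hw hwf hm)
    exact (T.eq_pole_of_mem_both hWE this).elim hN hS
  · refine T.α_notMem_pos hw (T.west_edges _ ?_ ?_ ?_ ?_)
    · rw [T.edge_α]
      exact (T.edge_mem_W_iff_left hm).2 hwf
    all_goals rw [T.head_α]
    · exact Or.inl hWE
    · exact hN
    · exact hS

/-- Again a local source of the face boundary is used, but now its other edge, with `f` on the left,
is forced onto `EW`. -/
theorem eq_NW_of_sink {f : T.Face} (hf : .face f ∈ T.W)
    (h : ∀ d ∈ T.pos, .edge (T.edge d) ∈ T.W → T.left d ≠ f) : f = T.NW := by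
  obtain ⟨⟨y, hy, rfl⟩, x, hx, hxf⟩ := CMap.exists_left_eq T.orientation T.bipolar.acyclic f
  obtain ⟨z, hxz, hz, hw⟩ := (T.left_eq_left_iff.1 hxf.symm).inv.exists_exit (· ∈ T.pos) hy hx
  obtain ⟨w, rfl⟩ := T.φ.surjective z
  rw [show T.φ⁻¹ (T.φ w) = w by simp] at hw
  rw [T.left_eq_left_iff.2 (Equiv.Perm.sameCycle_inv.1 hxz)] at hf h ⊢
  have hzm : .edge (T.edge (T.φ w)) ∈ T.meridians := by
    by_contra hm
    exact h _ hz ((T.edge_mem_W_iff_left hm).2 hf) rfl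
  have hzEW := T.mem_EW_of_left_mem_W hz hf hzm
  have hEW := T.EW_path.pathCells_vert_tail hzEW
  have hw' := T.α_mem_pos hw
  have hv : T.tail (T.φ w) = T.tail (T.α w) := T.tail_φ w
  have hwf : .face (T.right (T.α w)) ∈ T.W := by rwa [T.right_α, ← T.left_φ]
  have hS := T.bipolar.tail_ne hz
  by_cases hN : T.tail (T.φ w) = T.N
  · rw [T.EW_path.eq_of_tail_eq T.bipolar.acyclic hzEW (List.head_mem T.EW_ne)
      (hN.trans (T.EW_path.tail_head T.EW_ne).symm)]
    rfl
  exfalso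
  by_cases hm : .edge (T.edge (T.α w)) ∈ T.meridians
  · have := T.WE_path.pathCells_vert_tail (T.mem_WE_of_right_mem_W hw' hwf hm)
    rw [← hv] at this
    exact (T.eq_pole_of_mem_both this hEW).elim hN hS
  · refine hw (T.west_edges _ ?_ ?_ ?_ ?_)
    · rw [← T.edge_α]
      exact (T.edge_mem_W_iff_right hm).2 hwf
    all_goals rw [← T.tail_φ]
    · exact Or.inr hEW
    · exact hN
    · exact hS

/-- In `E` a local sink is used: of its two entering edges, the one with `f` on the right lies on
`EW`, and `east_edges` forbids the other to enter a nonpolar meridian vertex. So the vertex is `S`.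
-/
theorem eq_SE_of_source {f : T.Face} (hf : .face f ∈ T.E)
    (h : ∀ d ∈ T.pos, .edge (T.edge d) ∈ T.E → T.right d ≠ f) : f = T.SE := by
  obtain ⟨⟨y, hy, hyf⟩, x, hx, rfl⟩ := CMap.exists_left_eq T.orientation T.bipolar.acyclic f
  obtain ⟨z, hxz, hz, hw⟩ := (T.left_eq_left_iff.1 hyf.symm).inv.exists_exit (· ∉ T.pos) hx
    (not_not.2 hy)
  obtain ⟨w, rfl⟩ := T.φ.surjective z
  rw [not_not, show T.φ⁻¹ (T.φ w) = w by simp] at hw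
  rw [T.left_eq_left_iff.2 (Equiv.Perm.sameCycle_inv.1 hxz), ← T.right_α] at hf h ⊢
  have hz' := T.α_mem_pos hz
  have hzm : .edge (T.edge (T.α (T.φ w))) ∈ T.meridians := by
    by_contra hm
    exact h _ hz' ((T.edge_mem_E_iff_right hm).2 hf) rfl
  have hzEW := T.mem_EW_of_right_mem_E hz' hf hzm
  have hv : T.head w = T.head (T.α (T.φ w)) := by rw [T.head_α, T.tail_φ]
  have hEW : .vert (T.head w) ∈ T.pathCells T.N T.EW := hv ▸ CMap.pathCells_vert_head hzEW
  have hwf : .face (T.left w) ∈ T.E := by rwa [← T.left_φ, ← T.right_α]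
  have hN := T.bipolar.head_ne hw
  by_cases hS : T.head w = T.S
  · rw [T.EW_path.eq_of_head_eq T.bipolar.acyclic hzEW (List.getLast_mem T.EW_ne)
      ((hv.symm.trans hS).trans (T.EW_path.head_getLast T.EW_ne).symm)]
    rfl
  exfalso
  by_cases hm : .edge (T.edge w) ∈ T.meridians
  · exact (T.eq_pole_of_mem_both
      (CMap.pathCells_vert_head (T.mem_WE_of_left_mem_E hw hwf hm)) hEW).elim hN hS
  · refine T.α_notMem_pos hw (T.east_edges _ ?_ (Or.inr hEW) hN hS)
    rw [T.edge_α]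
    exact (T.edge_mem_E_iff_left hm).2 hwf

theorem eq_SW_of_sink {f : T.Face} (hf : .face f ∈ T.E)
    (h : ∀ d ∈ T.pos, .edge (T.edge d) ∈ T.E → T.left d ≠ f) : f = T.SW := by
  obtain ⟨⟨y, hy, rfl⟩, x, hx, hxf⟩ := CMap.exists_left_eq T.orientation T.bipolar.acyclic f
  obtain ⟨z, hxz, hz, hw⟩ := (T.left_eq_left_iff.1 hxf.symm).exists_exit (· ∈ T.pos) hy hx
  rw [T.left_eq_left_iff.2 hxz] at hf h ⊢
  have hzm : .edge (T.edge z) ∈ T.meridians := by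
    by_contra hm
    exact h _ hz ((T.edge_mem_E_iff_left hm).2 hf) rfl
  have hzWE := T.mem_WE_of_left_mem_E hz hf hzm
  have hWE : .vert (T.head z) ∈ T.pathCells T.N T.WE := CMap.pathCells_vert_head hzWE
  have hw' := T.α_mem_pos hw
  have hv : T.tail (T.φ z) = T.head z := T.tail_φ z
  have hwf : .face (T.right (T.α (T.φ z))) ∈ T.E := by rwa [T.right_α, T.left_φ]
  have hN := T.bipolar.head_ne hz
  by_cases hS : T.head z = T.S
  · rw [T.WE_path.eq_of_head_eq T.bipolar.acyclic hzWE (List.getLast_mem T.WE_ne)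
      (hS.trans (T.WE_path.head_getLast T.WE_ne).symm)]
    rfl
  exfalso
  by_cases hm : .edge (T.edge (T.α (T.φ z))) ∈ T.meridians
  · have : .vert (T.head (T.α (T.φ z))) ∈ T.pathCells T.N T.EW :=
      CMap.pathCells_vert_head (T.mem_EW_of_right_mem_E hw' hwf hm)
    rw [T.head_α, hv] at this
    exact (T.eq_pole_of_mem_both hWE this).elim hN hS
  · refine hw (T.east_edges _ ?_ ?_ ?_ ?_)
    · rw [← T.edge_α]
      exact (T.edge_mem_E_iff_right hm).2 hwf
    all_goals rw [hv]
    · exact Or.inl hWE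
    · exact hN
    · exact hS

/-- Core edges avoid `WE`, a directed path between the poles, so `dual_acyclic` applies. -/
theorem isCoreBipolar_W : T.IsCoreBipolar T.coreW T.wm0 T.wm1 := by
  have hedge : ∀ d, (CMap.Cell.edge (T.dual.edge d) : T.dual.Cell) ∈ T.coreW →
      .edge (T.edge d) ∈ T.W := fun d h => CMap.edge_mem_dualCell_image.1 h
  refine CMap.IsBipolar.of_unique ?_ (CMap.vert_mem_dualCell_image.2 T.NE_mem_W)
    (CMap.vert_mem_dualCell_image.2 T.NW_mem_W) ?_ ?_ ?_
  · intro u p hp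
    refine T.bipolar.dual_acyclic T.sphere T.orientation T.WE_path (fun d hd => hd.1) ?_ hp
    intro d hd h
    exact T.notMem_meridians_of_mem_W (hedge d h.2) (T.edge_mem_meridians.2 (Or.inl (Or.inl hd)))
  · intro d hd
    have h1 := hedge d hd.2
    have h2 := T.notMem_meridians_of_mem_W h1
    exact ⟨CMap.vert_mem_dualCell_image.2 ((T.edge_mem_W_iff_left h2).1 h1),
      CMap.vert_mem_dualCell_image.2 ((T.edge_mem_W_iff_right h2).1 h1)⟩
  · intro f hf h
    exact T.eq_NE_of_source (CMap.vert_mem_dualCell_image.1 hf) fun d hd hdW =>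
      h d ⟨hd, CMap.edge_mem_dualCell_image.2 hdW⟩
  · intro f hf h
    exact T.eq_NW_of_sink (CMap.vert_mem_dualCell_image.1 hf) fun d hd hdW =>
      h d ⟨hd, CMap.edge_mem_dualCell_image.2 hdW⟩

theorem isCoreBipolar_E : T.IsCoreBipolar T.coreE T.wp0 T.wp1 := by
  have hedge : ∀ d, (CMap.Cell.edge (T.dual.edge d) : T.dual.Cell) ∈ T.coreE →
      .edge (T.edge d) ∈ T.E := fun d h => CMap.edge_mem_dualCell_image.1 h
  refine CMap.IsBipolar.of_unique ?_ (CMap.vert_mem_dualCell_image.2 T.SE_mem_E)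
    (CMap.vert_mem_dualCell_image.2 T.SW_mem_E) ?_ ?_ ?_
  · intro u p hp
    refine T.bipolar.dual_acyclic T.sphere T.orientation T.WE_path (fun d hd => hd.1) ?_ hp
    intro d hd h
    exact T.notMem_meridians_of_mem_E (hedge d h.2) (T.edge_mem_meridians.2 (Or.inl (Or.inl hd)))
  · intro d hd
    have h1 := hedge d hd.2
    have h2 := T.notMem_meridians_of_mem_E h1
    exact ⟨CMap.vert_mem_dualCell_image.2 ((T.edge_mem_E_iff_left h2).1 h1),
      CMap.vert_mem_dualCell_image.2 ((T.edge_mem_E_iff_right h2).1 h1)⟩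
  · intro f hf h
    exact T.eq_SE_of_source (CMap.vert_mem_dualCell_image.1 hf) fun d hd hdE =>
      h d ⟨hd, CMap.edge_mem_dualCell_image.2 hdE⟩
  · intro f hf h
    exact T.eq_SW_of_sink (CMap.vert_mem_dualCell_image.1 hf) fun d hd hdE =>
      h d ⟨hd, CMap.edge_mem_dualCell_image.2 hdE⟩

theorem wm0_eq_wm1_iff :
    T.wm0 = T.wm1 ↔ T.coreW = {.vert T.wm0} ∧ T.coreW = {.vert T.wm1} := by
  constructor
  · intro h
    have hb := T.isCoreBipolar_W
    rw [← h] at hb ⊢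
    exact ⟨T.core_eq_singleton T.NE_mem_W hb, T.core_eq_singleton T.NE_mem_W hb⟩
  · rintro ⟨h1, h2⟩
    exact CMap.Cell.vert.inj (Set.singleton_injective (h1.symm.trans h2))

theorem wp0_eq_wp1_iff :
    T.wp0 = T.wp1 ↔ T.coreE = {.vert T.wp0} ∧ T.coreE = {.vert T.wp1} := by
  constructor
  · intro h
    have hb := T.isCoreBipolar_E
    rw [← h] at hb ⊢
    exact ⟨T.core_eq_singleton T.SE_mem_E hb, T.core_eq_singleton T.SE_mem_E hb⟩
  · rintro ⟨h1, h2⟩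
    exact CMap.Cell.vert.inj (Set.singleton_injective (h1.symm.trans h2))

end ThreeCellTemplate

/-! ### Polar circles, bridges and polar segments. -/

namespace ThreeCellTemplate

variable {D : Type*} (T : ThreeCellTemplate D)

/-- All darts with tail `N` are positive, as are all darts with head `S`; hence tails describe one
circle and heads the other. -/
theorem circleN_eq : T.circleN =
    {x | ∃ d, T.tail d = T.N ∧ (x = .edge (T.dual.edge d) ∨ x = .vert (T.dual.tail d))} :=
  CMap.faceBoundary_dualFace_eq_tail T.N

theorem circleS_eq : T.circleS =
    {x | ∃ d, T.head d = T.S ∧ (x = .edge (T.dual.edge d) ∨ x = .vert (T.dual.tail d))} :=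
  CMap.faceBoundary_dualFace T.S

theorem edge_mem_circleN {d : D} (h : T.tail d = T.N) : .edge (T.dual.edge d) ∈ T.circleN := by
  rw [circleN_eq]
  exact ⟨d, h, Or.inl rfl⟩

theorem edge_mem_circleS {d : D} (h : T.head d = T.S) : .edge (T.dual.edge d) ∈ T.circleS := by
  rw [circleS_eq]
  exact ⟨d, h, Or.inl rfl⟩

theorem N_ne_S : T.N ≠ T.S := fun h =>
  T.WE_ne (T.bipolar.acyclic T.N T.WE (by simpa only [← h] using T.WE_path))

theorem exists_shared_edge_iff :
    (∃ e, .edge e ∈ T.circleN ∩ T.circleS) ↔ T.skeleton.dist T.N T.S = 1 := by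
  rw [SimpleGraph.dist_eq_one_iff_adj, CMap.skeleton, SimpleGraph.fromRel_adj]
  constructor
  · rintro ⟨e, he, he'⟩
    rw [circleN_eq] at he
    rw [circleS_eq] at he'
    obtain ⟨d, hd, h | h⟩ := he
    swap
    · cases h
    obtain ⟨d', hd', h' | h'⟩ := he'
    swap
    · cases h'
    refine ⟨T.N_ne_S, Or.inl ⟨d, hd, ?_⟩⟩
    rcases T.edge_eq_edge_iff.1 ((CMap.Cell.edge.inj h).symm.trans (CMap.Cell.edge.inj h'))
      with rfl | rfl
    · exact hd'
    · exact absurd (hd.symm.trans ((T.head_α d).symm.trans hd')) T.N_ne_S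
  · have key : ∀ d, T.tail d = T.N → T.head d = T.S →
        ∃ e, .edge e ∈ T.circleN ∩ T.circleS := fun d h h' =>
      ⟨T.dual.edge d, T.edge_mem_circleN h, T.edge_mem_circleS h'⟩
    rintro ⟨-, ⟨d, h, h'⟩ | ⟨d, h, h'⟩⟩
    · exact key d h h'
    · exact key (T.α d) h' ((T.head_α d).trans h)

theorem wm0_mem_circleN : .vert T.wm0 ∈ T.circleN := by
  rw [circleN, CMap.faceBoundary_dualFace]
  refine ⟨T.α (T.WE.head T.WE_ne), ?_, Or.inr rfl⟩
  rw [T.head_α, T.WE_path.tail_head]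

theorem wm1_mem_circleN : .vert T.wm1 ∈ T.circleN := by
  rw [circleN_eq]
  exact ⟨T.EW.head T.EW_ne, T.EW_path.tail_head _, Or.inr rfl⟩

theorem wp0_mem_circleS : .vert T.wp0 ∈ T.circleS := by
  rw [circleS, CMap.faceBoundary_dualFace_eq_tail]
  refine ⟨T.α (T.EW.getLast T.EW_ne), ?_, Or.inr rfl⟩
  rw [T.tail_α, T.EW_path.head_getLast]

theorem wp1_mem_circleS : .vert T.wp1 ∈ T.circleS := by
  rw [circleS_eq]
  exact ⟨T.WE.getLast T.WE_ne, T.WE_path.head_getLast _, Or.inr rfl⟩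

theorem edge_mem_dualWE {d : D} : .edge (T.dual.edge d) ∈ T.dualWE ↔ d ∈ T.WE ∨ T.α d ∈ T.WE := by
  rw [← CMap.edge_mem_pathCells (u := T.N)]
  exact CMap.edge_mem_dualCell_image.trans
    ⟨fun h => h.1, fun h => ⟨h, by rintro (h | h) <;> cases h⟩⟩

theorem edge_mem_dualEW {d : D} : .edge (T.dual.edge d) ∈ T.dualEW ↔ d ∈ T.EW ∨ T.α d ∈ T.EW := by
  rw [← CMap.edge_mem_pathCells (u := T.N)]
  exact CMap.edge_mem_dualCell_image.trans
    ⟨fun h => h.1, fun h => ⟨h, by rintro (h | h) <;> cases h⟩⟩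

theorem face_notMem_pathCells {u : T.Vertex} {p : List D} {f : T.Face} :
    .face f ∉ T.pathCells u p := by
  rintro (h | ⟨_, _, h | h⟩) <;> cases h

/-- The meridian dual contains no dual vertices, because a path contains no faces, and only the
first edge of `WE` touches `N`. The three analogues argue alike. -/
theorem dualWE_inter_circleN :
    T.dualWE ∩ T.circleN = {.edge (T.dual.edge (T.WE.head T.WE_ne))} := by
  refine Set.Subset.antisymm ?_ (Set.singleton_subset_iff.2
    ⟨T.edge_mem_dualWE.2 (Or.inl (List.head_mem _)), T.edge_mem_circleN (T.WE_path.tail_head _)⟩)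
  rw [circleN_eq]
  rintro x ⟨hx, d, hd, rfl | rfl⟩
  · rcases T.edge_mem_dualWE.1 hx with h | h
    · rw [T.WE_path.eq_of_tail_eq T.bipolar.acyclic h (List.head_mem T.WE_ne)
        (hd.trans (T.WE_path.tail_head _).symm)]
      rfl
    · exact absurd ((T.head_α d).trans hd) (T.bipolar.head_ne (T.WE_path.mem h))
  · exact absurd (CMap.vert_mem_dualCell_image.1 hx).1 T.face_notMem_pathCells

theorem dualEW_inter_circleN :
    T.dualEW ∩ T.circleN = {.edge (T.dual.edge (T.EW.head T.EW_ne))} := by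
  refine Set.Subset.antisymm ?_ (Set.singleton_subset_iff.2
    ⟨T.edge_mem_dualEW.2 (Or.inl (List.head_mem _)), T.edge_mem_circleN (T.EW_path.tail_head _)⟩)
  rw [circleN_eq]
  rintro x ⟨hx, d, hd, rfl | rfl⟩
  · rcases T.edge_mem_dualEW.1 hx with h | h
    · rw [T.EW_path.eq_of_tail_eq T.bipolar.acyclic h (List.head_mem T.EW_ne)
        (hd.trans (T.EW_path.tail_head _).symm)]
      rfl
    · exact absurd ((T.head_α d).trans hd) (T.bipolar.head_ne (T.EW_path.mem h))
  · exact absurd (CMap.vert_mem_dualCell_image.1 hx).1 T.face_notMem_pathCells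

theorem dualWE_inter_circleS :
    T.dualWE ∩ T.circleS = {.edge (T.dual.edge (T.WE.getLast T.WE_ne))} := by
  refine Set.Subset.antisymm ?_ (Set.singleton_subset_iff.2
    ⟨T.edge_mem_dualWE.2 (Or.inl (List.getLast_mem _)),
      T.edge_mem_circleS (T.WE_path.head_getLast _)⟩)
  rw [circleS_eq]
  rintro x ⟨hx, d, hd, rfl | rfl⟩
  · rcases T.edge_mem_dualWE.1 hx with h | h
    · rw [T.WE_path.eq_of_head_eq T.bipolar.acyclic h (List.getLast_mem T.WE_ne)
        (hd.trans (T.WE_path.head_getLast _).symm)]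
      rfl
    · exact absurd hd (T.bipolar.tail_ne (T.WE_path.mem h))
  · exact absurd (CMap.vert_mem_dualCell_image.1 hx).1 T.face_notMem_pathCells

theorem dualEW_inter_circleS :
    T.dualEW ∩ T.circleS = {.edge (T.dual.edge (T.EW.getLast T.EW_ne))} := by
  refine Set.Subset.antisymm ?_ (Set.singleton_subset_iff.2
    ⟨T.edge_mem_dualEW.2 (Or.inl (List.getLast_mem _)),
      T.edge_mem_circleS (T.EW_path.head_getLast _)⟩)
  rw [circleS_eq]
  rintro x ⟨hx, d, hd, rfl | rfl⟩
  · rcases T.edge_mem_dualEW.1 hx with h | h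
    · rw [T.EW_path.eq_of_head_eq T.bipolar.acyclic h (List.getLast_mem T.EW_ne)
        (hd.trans (T.EW_path.head_getLast _).symm)]
      rfl
    · exact absurd hd (T.bipolar.tail_ne (T.EW_path.mem h))
  · exact absurd (CMap.vert_mem_dualCell_image.1 hx).1 T.face_notMem_pathCells

theorem left_or_right_of_edge_mem_faceBoundary {d : D} {f : T.Face}
    (h : .edge (T.edge d) ∈ T.faceBoundary f) : T.left d = f ∨ T.right d = f := by
  change CMap.Cell.Lt T.toCMap (.edge (T.edge d)) (.face f) at h
  generalize hx : CMap.Cell.edge (T.edge d) = x at h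
  generalize hy : CMap.Cell.face f = y at h
  cases h with
  | vert_edge d' => cases hx
  | edge_face d' =>
    rw [CMap.Cell.face.inj hy]
    rcases T.edge_eq_edge_iff.1 (CMap.Cell.edge.inj hx) with rfl | rfl
    · exact Or.inl rfl
    · exact Or.inr rfl
  | vert_face d' => cases hx

/-- The tails of a segment followed by its outgoing bridge are exactly the vertices of that segment,
so simplicity reduces to simplicity and disjointness of the two segments. -/
theorem isDiCycle_of_segments {A B X Y : Set T.dual.Cell} {u u' v v' : T.dual.Vertex}
    {p q : List D} {b b' : D} (hp : T.IsSegment A u u' p) (hq : T.IsSegment B v v' q)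
    (hAB : Disjoint A B) (hb : T.IsBridge X u' v b) (hb' : T.IsBridge Y v' u b') :
    T.dual.IsDiCycle T.pos (p ++ b :: q ++ [b']) := by
  obtain ⟨hp, hpn, rfl⟩ := hp
  obtain ⟨hq, hqn, rfl⟩ := hq
  obtain ⟨hbP, -, rfl, rfl⟩ := hb
  obtain ⟨hbP', -, rfl, rfl⟩ := hb'
  refine ⟨by simp, ⟨_, CMap.isDiPath_append.2 ⟨_, CMap.isDiPath_append.2
    ⟨_, hp, hbP, rfl, hq⟩, hbP', rfl, rfl⟩⟩, ?_⟩
  have : (p ++ b :: q ++ [b']).map T.dual.tail =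
      (p.map T.dual.tail ++ [T.dual.tail b]) ++ (q.map T.dual.tail ++ [T.dual.tail b']) := by simp
  rw [this, hp.map_tail_append, hq.map_tail_append, List.nodup_append]
  refine ⟨hpn, hqn, fun x hx y hy hxy => ?_⟩
  exact Set.disjoint_left.1 hAB (CMap.vert_mem_pathCells.2 hx)
    (CMap.vert_mem_pathCells.2 (hxy ▸ hy))

variable [Finite D]

/-- The bridge is dual to an overlap edge; since the hemispheres are disjoint, `NW` must be on its
left and `SE` on its right. -/
theorem exists_bridge_EW : ∃ b ∈ T.EW, T.IsBridge T.dualEW T.wm1 T.wp0 b := by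
  obtain ⟨d, hd, h, h'⟩ := T.overlap_EW
  refine ⟨d, hd, T.EW_path.mem hd, T.edge_mem_dualEW.2 (Or.inl hd), ?_, ?_⟩
  · refine (T.left_or_right_of_edge_mem_faceBoundary h).resolve_right fun h => ?_
    exact T.notMem_E T.NW_mem_W (h ▸ T.right_mem_E hd)
  · refine (T.left_or_right_of_edge_mem_faceBoundary h').resolve_left fun h => ?_
    exact T.notMem_E (h ▸ T.left_mem_W hd) T.SE_mem_E

theorem exists_bridge_WE : ∃ b ∈ T.WE, T.IsBridge T.dualWE T.wp1 T.wm0 b := by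
  obtain ⟨d, hd, h, h'⟩ := T.overlap_WE
  refine ⟨d, hd, T.WE_path.mem hd, T.edge_mem_dualWE.2 (Or.inl hd), ?_, ?_⟩
  · refine (T.left_or_right_of_edge_mem_faceBoundary h').resolve_right fun h => ?_
    exact T.notMem_E (h ▸ T.right_mem_W hd) T.SW_mem_E
  · refine (T.left_or_right_of_edge_mem_faceBoundary h).resolve_left fun h => ?_
    exact T.notMem_E T.NE_mem_W (h ▸ T.left_mem_E hd)

theorem edgeDist_le_one : T.edgeDist T.circleN T.circleS ≤ 1 := by
  obtain ⟨b, -, -, -, ht, hh⟩ := T.exists_bridge_EW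
  refine (iInf₂_le T.wm1 T.wm1_mem_circleN).trans
    ((iInf₂_le T.wp0 T.wp0_mem_circleS).trans ?_)
  rw [SimpleGraph.edist_le_one_iff_adj_or_eq]
  by_cases h : T.wm1 = T.wp0
  · exact Or.inr h
  · exact Or.inl ((SimpleGraph.fromRel_adj _ _ _).2 ⟨h, Or.inl ⟨b, ht, hh⟩⟩)

/-- The dual circle at `N` is followed by `σ⁻¹`, from the first edge of `WE` to that of `EW`, the
only crossings of the meridians. Regularity prevents a face from occurring twice around `N`. -/
theorem exists_segment_W : ∃ p : List D,
    T.IsSegment (T.coreW ∩ T.circleN) T.wm0 T.wm1 p ∧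
    (T.WE.head T.WE_ne :: p ++ [T.EW.head T.EW_ne]).Nodup ∧ ∀ d ∈ p, T.tail d = T.N := by
  set a := T.WE.head T.WE_ne with ha
  set c := T.EW.head T.EW_ne with hc
  have haN : T.tail a = T.N := T.WE_path.tail_head _
  have hcN : T.tail c = T.N := T.EW_path.tail_head _
  have hae : .edge (T.edge a) ∈ T.meridians :=
    T.edge_mem_meridians.2 (Or.inl (Or.inl (List.head_mem _)))
  have hce : .edge (T.edge c) ∈ T.meridians :=
    T.edge_mem_meridians.2 (Or.inr (Or.inl (List.head_mem _)))
  have horb : ∀ d, T.σ⁻¹.SameCycle a d ↔ T.tail d = T.N := fun d => by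
    rw [Equiv.Perm.sameCycle_inv, ← T.tail_eq_tail_iff, haN, eq_comm]
  have hmer : ∀ d, T.tail d = T.N → d ≠ a → d ≠ c → .edge (T.edge d) ∉ T.meridians :=
    fun d hd h1 h2 h => (T.eq_head_of_tail_eq_N hd h).elim h1 h2
  obtain ⟨p, h1, h2, h3, h4, h5⟩ := CMap.exists_dual_arc (M := T.toCMap) (P := T.pos) (C := T.W)
    (τ := T.σ⁻¹) (a := a) (c := c) T.right_eq_left_σ_inv ((horb c).2 hcN) T.WE_head_ne_EW_head
    (fun d hd => by_contra fun h => T.bipolar.head_ne (T.α_mem_pos h)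
      ((T.head_α d).trans ((horb d).1 hd)))
    (fun d d' hd hd' h => T.regular.face_simple d d' h
      (((horb d).1 hd).trans ((horb d').1 hd').symm))
    T.NE_mem_W (fun h => T.notMem_E h (T.right_mem_E (List.head_mem _)))
    (fun h => T.notMem_meridians_of_mem_W h hae) (fun h => T.notMem_meridians_of_mem_W h hce)
    (fun d hd h h' => T.edge_mem_W_iff_left (hmer d ((horb d).1 hd) h h'))
    (fun d hd h h' => T.edge_mem_W_iff_right (hmer d ((horb d).1 hd) h h'))
  refine ⟨p, ⟨h1, h2, h5.trans ?_⟩, h3, fun d hd => (horb d).1 (h4 d hd)⟩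
  simp only [horb, circleN_eq]
  rfl

theorem exists_segment_E : ∃ q : List D,
    T.IsSegment (T.coreE ∩ T.circleS) T.wp0 T.wp1 q ∧
    (T.EW.getLast T.EW_ne :: q ++ [T.WE.getLast T.WE_ne]).Nodup ∧ ∀ d ∈ q, T.head d = T.S := by
  set a := T.EW.getLast T.EW_ne with ha
  set c := T.WE.getLast T.WE_ne with hc
  have haS : T.head a = T.S := T.EW_path.head_getLast _
  have hcS : T.head c = T.S := T.WE_path.head_getLast _
  have hae : .edge (T.edge a) ∈ T.meridians :=
    T.edge_mem_meridians.2 (Or.inr (Or.inl (List.getLast_mem _)))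
  have hce : .edge (T.edge c) ∈ T.meridians :=
    T.edge_mem_meridians.2 (Or.inl (Or.inl (List.getLast_mem _)))
  have horb : ∀ d, T.dual.φ.SameCycle a d ↔ T.head d = T.S := fun d => by
    rw [← T.dual.left_eq_left_iff, T.dual_left, T.dual_left, T.dualFace_injective.eq_iff, haS,
      eq_comm]
  have hmer : ∀ d, T.head d = T.S → d ≠ a → d ≠ c → .edge (T.edge d) ∉ T.meridians :=
    fun d hd h1 h2 h => (T.eq_getLast_of_head_eq_S hd h).elim h2 h1
  obtain ⟨q, h1, h2, h3, h4, h5⟩ := CMap.exists_dual_arc (M := T.toCMap) (P := T.pos) (C := T.E)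
    (τ := T.dual.φ) (a := a) (c := c) (fun d => (T.dual.tail_φ d).symm)
    ((horb c).2 hcS) T.WE_getLast_ne_EW_getLast.symm
    (fun d hd => by_contra fun h => T.bipolar.tail_ne (T.α_mem_pos h) ((horb d).1 hd))
    -- Regularity compares darts with a common tail, so each dart into `S` is replaced by its
    -- successor along the face, which starts at `S`.
    (fun d d' hd hd' h => T.φ.injective <| T.regular.face_simple _ _
      (by rw [T.left_φ, T.left_φ, h])
      (by rw [T.tail_φ, T.tail_φ, (horb d).1 hd, (horb d').1 hd']))
    T.SE_mem_E (T.notMem_E (T.right_mem_W (List.getLast_mem _)))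
    (fun h => T.notMem_meridians_of_mem_E h hae) (fun h => T.notMem_meridians_of_mem_E h hce)
    (fun d hd h h' => T.edge_mem_E_iff_left (hmer d ((horb d).1 hd) h h'))
    (fun d hd h h' => T.edge_mem_E_iff_right (hmer d ((horb d).1 hd) h h'))
  refine ⟨q, ⟨h1, h2, h5.trans ?_⟩, h3, fun d hd => (horb d).1 (h4 d hd)⟩
  simp only [horb, circleS_eq]
  rfl

theorem disjoint_cores (X Y : Set T.dual.Cell) : Disjoint (T.coreW ∩ X) (T.coreE ∩ Y) := by
  rw [Set.disjoint_left]
  rintro _ ⟨⟨x, hx, rfl⟩, -⟩ ⟨hy, -⟩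
  refine T.notMem_E hx ?_
  cases x with
  | vert v => exact CMap.face_mem_dualCell_image.1 hy
  | edge e => exact CMap.edge_mem_dualCell_image.1 hy
  | face f => exact CMap.vert_mem_dualCell_image.1 hy

theorem length_le_edgeLength {X : Set T.dual.Cell} {l : List D} (hl : l.Nodup)
    (hP : ∀ d ∈ l, d ∈ T.pos) (hX : ∀ d ∈ l, .edge (T.dual.edge d) ∈ X) :
    l.length ≤ T.edgeLength X :=
  CMap.IsOrientation.length_le_ncard (M := T.dual) T.orientation hl hP hX

end ThreeCellTemplate

/-! ### Assembly of the statements. -/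

theorem corollary5p2 {D : Type*} [Finite D] (T : ThreeCellTemplate D) :
    -- (i) shared edges of the polar circles
    ((∃ e, .edge e ∈ T.circleN ∩ T.circleS) ↔ T.skeleton.dist T.N T.S = 1) ∧
    -- (ii) the core poles, and singleton cores
    (T.IsCoreBipolar T.coreW T.wm0 T.wm1 ∧
      (T.wm0 = T.wm1 ↔ T.coreW = {.vert T.wm0} ∧ T.coreW = {.vert T.wm1})) ∧
    (T.IsCoreBipolar T.coreE T.wp0 T.wp1 ∧
      (T.wp0 = T.wp1 ↔ T.coreE = {.vert T.wp0} ∧ T.coreE = {.vert T.wp1})) ∧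
    -- (iii) distance of the polar circles, and polar bridges
    (T.edgeDist T.circleN T.circleS ≤ 1 ∧
      .vert T.wm0 ∈ T.circleN ∧ .vert T.wm1 ∈ T.circleN ∧
      .vert T.wp0 ∈ T.circleS ∧ .vert T.wp1 ∈ T.circleS ∧
      ∃ b b', T.IsBridge T.dualEW T.wm1 T.wp0 b ∧ T.IsBridge T.dualWE T.wp1 T.wm0 b' ∧
        T.dual.edge b ≠ T.dual.edge b') ∧
    -- the polar segments `p` from `w₋⁰` to `w₋¹` and `q` from `w₊⁰` to `w₊¹`
    ∃ p q : List D,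
      T.IsSegment (T.coreW ∩ T.circleN) T.wm0 T.wm1 p ∧
      T.IsSegment (T.coreE ∩ T.circleS) T.wp0 T.wp1 q ∧
      -- (iv) they are disjoint, and close up with the bridges to a directed cycle
      Disjoint (T.dual.pathCells T.wm0 p) (T.dual.pathCells T.wp0 q) ∧
      (∀ b b', T.IsBridge T.dualEW T.wm1 T.wp0 b → T.IsBridge T.dualWE T.wp1 T.wm0 b' →
        T.dual.IsDiCycle T.pos (p ++ b :: q ++ [b'])) ∧
      -- (v) the edges which precede and follow the segments on the polar circles
      (∃ a c, T.dualWE ∩ T.circleN = {.edge (T.dual.edge a)} ∧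
        T.dualEW ∩ T.circleN = {.edge (T.dual.edge c)} ∧
        T.dual.edge a ≠ T.dual.edge c ∧
        T.dual.IsDiPath T.pos (T.dual.tail a) (T.dual.head c) (a :: p ++ [c]) ∧
        T.dual.head a = T.wm0 ∧ T.dual.tail c = T.wm1) ∧
      (∃ a c, T.dualEW ∩ T.circleS = {.edge (T.dual.edge a)} ∧
        T.dualWE ∩ T.circleS = {.edge (T.dual.edge c)} ∧
        T.dual.edge a ≠ T.dual.edge c ∧
        T.dual.IsDiPath T.pos (T.dual.tail a) (T.dual.head c) (a :: q ++ [c]) ∧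
        T.dual.head a = T.wp0 ∧ T.dual.tail c = T.wp1) ∧
      -- (vi) lengths
      p.length + 2 ≤ T.edgeLength T.circleN ∧
      q.length + 2 ≤ T.edgeLength T.circleS := by
  obtain ⟨b, hbEW, hb⟩ := T.exists_bridge_EW
  obtain ⟨b', hbWE, hb'⟩ := T.exists_bridge_WE
  obtain ⟨p, hp, hpn, hpN⟩ := T.exists_segment_W
  obtain ⟨q, hq, hqn, hqS⟩ := T.exists_segment_E
  have hdisj : Disjoint (T.coreW ∩ T.circleN) (T.coreE ∩ T.circleS) := T.disjoint_cores _ _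
  have hWEh : T.WE.head T.WE_ne ∈ T.WE := List.head_mem _
  have hEWh : T.EW.head T.EW_ne ∈ T.EW := List.head_mem _
  have hWEl : T.WE.getLast T.WE_ne ∈ T.WE := List.getLast_mem _
  have hEWl : T.EW.getLast T.EW_ne ∈ T.EW := List.getLast_mem _
  refine ⟨T.exists_shared_edge_iff, ⟨T.isCoreBipolar_W, T.wm0_eq_wm1_iff⟩,
    ⟨T.isCoreBipolar_E, T.wp0_eq_wp1_iff⟩,
    ⟨T.edgeDist_le_one, T.wm0_mem_circleN, T.wm1_mem_circleN, T.wp0_mem_circleS,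
      T.wp1_mem_circleS, b, b', hb, hb', (T.edge_ne_of_mem hbWE hbEW).symm⟩,
    p, q, hp, hq, hp.2.2.symm ▸ hq.2.2.symm ▸ hdisj,
    fun _ _ hb hb' => T.isDiCycle_of_segments hp hq hdisj hb hb', ?_, ?_, ?_, ?_⟩
  · exact ⟨_, _, T.dualWE_inter_circleN, T.dualEW_inter_circleN, T.edge_ne_of_mem hWEh hEWh,
      CMap.isDiPath_append.2 ⟨_, ⟨T.WE_path.mem hWEh, rfl, hp.1⟩, T.EW_path.mem hEWh, rfl, rfl⟩,
      rfl, rfl⟩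
  · exact ⟨_, _, T.dualEW_inter_circleS, T.dualWE_inter_circleS,
      (T.edge_ne_of_mem hWEl hEWl).symm,
      CMap.isDiPath_append.2 ⟨_, ⟨T.EW_path.mem hEWl, rfl, hq.1⟩, T.WE_path.mem hWEl, rfl, rfl⟩,
      rfl, rfl⟩
  -- The segment and the two meridian edges adjacent to it are distinct positive darts on the
  -- circle, whence the summand 2.
  · have hlen := T.length_le_edgeLength (X := T.circleN) hpn ?_ ?_
    · simpa only [List.cons_append, List.length_cons, List.length_append, List.length_nil] using hlen
    · simp only [List.cons_append, List.mem_cons, List.mem_append, List.not_mem_nil, or_false]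
      rintro d (rfl | h | rfl)
      · exact T.WE_path.mem hWEh
      · exact hp.1.mem h
      · exact T.EW_path.mem hEWh
    · simp only [List.cons_append, List.mem_cons, List.mem_append, List.not_mem_nil, or_false]
      rintro d (rfl | h | rfl)
      · exact T.edge_mem_circleN (T.WE_path.tail_head _)
      · exact T.edge_mem_circleN (hpN d h)
      · exact T.edge_mem_circleN (T.EW_path.tail_head _)
  · have hlen := T.length_le_edgeLength (X := T.circleS) hqn ?_ ?_
    · simpa only [List.cons_append, List.length_cons, List.length_append, List.length_nil] using hlen
    · simp only [List.cons_append, List.mem_cons, List.mem_append, List.not_mem_nil, or_false]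
      rintro d (rfl | h | rfl)
      · exact T.EW_path.mem hEWl
      · exact hq.1.mem h
      · exact T.WE_path.mem hWEl
    · simp only [List.cons_append, List.mem_cons, List.mem_append, List.not_mem_nil, or_false]
      rintro d (rfl | h | rfl)
      · exact T.edge_mem_circleS (T.EW_path.head_getLast _)
      · exact T.edge_mem_circleS (hqS d h)
      · exact T.edge_mem_circleS (T.WE_path.head_getLast _)
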